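/- Fix an inverse temperature $\beta>0$. Let $A$ and $B$ be finite-dimensional quantum systems with Hamiltonians (Hermitian operators) $H^A=\sum_{x=1}^m a_x|x\rangle\langle x|^A$ and $H^B=\sum_{y=1}^n b_y|y\rangle\langle y|^B$, where $\{|x\rangle^A\}$ and $\{|y\rangle^B\}$ are orthonormal energy eigenbases. Assume that the Hamiltonians are relatively non-degenerate: for all $x,x'\in\{1,\dots,m\}$ and $y,y'\in\{1,\dots,n\}$, $a_x-a_{x'}=b_y-b_{y'}$ implies $x=x'$ and $y=y'$. For a system $S$ with Hamiltonian $H^S$ let $\gamma^S=e^{-\beta H^S}/\mathrm{Tr}[e^{-\beta H^S}]$ be its Gibbs state. A thermal operation from $A$ to $B$ is a map of the form $\omega\mapsto\mathrm{Tr}_{S}\left[U(\omega\otimes\gamma^{R})U^*\right]$, where $R$ and $S$ are finite-dimensional systems with (arbitrary) Hamiltonians and $U$ is a unitary from $A\otimes R$ onto $B\otimes S$ with $U(\gamma^A\otimes\gamma^R)U^*=\gamma^B\otimes\gamma^S$. $\mathrm{CTO}(A\to B)$ is the set of quantum channels (completely positive trace-preserving linear maps) from $A$ to $B$ that are limits of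 sequences of thermal operations. $\mathrm{GPC}(A\to B)$ is the set of quantum channels $\mathcal E$ from $A$ to $B$ with $\mathcal E(\gamma^A)=\gamma^B$ and $\mathcal E(e^{-iH^At}\omega e^{iH^At})=e^{-iH^Bt}\mathcal E(\omega)e^{iH^Bt}$ for all $t\in\mathbb R$ and all density matrices $\omega$ on $A$. For $\mathfrak F\in\{\mathrm{CTO},\mathrm{GPC}\}$ write $(\rho^A,\gamma^A)\xrightarrow{\mathfrak F}(\sigma^B,\gamma^B)$ if there is $\mathcal E\in\mathfrak F(A\to B)$ with $\mathcal E(\rho^A)=\sigma^B$. Let $\rho^A$ and $\sigma^B$ be density matrices on $A$ and $B$, and let $\mathbf r^A,\mathbf s^B,\mathbf g^A,\mathbf g^B$ be the vectors of diagonal elements of $\rho^A,\sigma^B,\gamma^A,\gamma^B$ in the respective energy eigenbases. Let $\mathfrak F$ be either $\mathrm{CTO}$ or $\mathrm{GPC}$. Then the following are equivalent: 1. $(\rho^A,\gamma^A)\xrightarrow{\mathfrak F}(\sigma^B,\gamma^B)$. 2. $\sigma^B$ is diagonal in the energy eigenbasis of $B$, and $(\mathbf r^A,\mathbf g^A)$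 relatively majorizes $(\mathbf s^B,\mathbf g^B)$, i.e. there is a column stochastic $n\times m$ matrix $T$ with $\mathbf s^B=T\mathbf r^A$ and $\mathbf g^B=T\mathbf g^A$. -/

import Mathlib

open Matrix Filter Topology
open scoped Kronecker ComplexOrder

namespace Athermality

/-- Density matrices on the Hilbert space with computational basis `ι`. -/
def IsDensity {ι : Type*} [Fintype ι] [DecidableEq ι] (ρ : Matrix ι ι ℂ) : Prop :=
  ρ.PosSemidef ∧ ρ.trace = 1

/-- The map `id_k ⊗ E` on `k × k` block matrices: `E` is applied to every block. -/
def ampliation {ι κ : Type*} (k : ℕ) (E : Matrix ι ι ℂ →ₗ[ℂ] Matrix κ κ ℂ)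
    (X : Matrix (Fin k × ι) (Fin k × ι) ℂ) : Matrix (Fin k × κ) (Fin k × κ) ℂ :=
  Matrix.of fun u v => E (Matrix.of fun p q => X (u.1, p) (v.1, q)) u.2 v.2

/-- Quantum channels: completely positive trace-preserving linear maps. -/
def CPTP (ι κ : Type*) [Fintype ι] [DecidableEq ι] [Fintype κ] [DecidableEq κ] :
    Set (Matrix ι ι ℂ →ₗ[ℂ] Matrix κ κ ℂ) :=
  {E | (∀ (k : ℕ) (X : Matrix (Fin k × ι) (Fin k × ι) ℂ),
          X.PosSemidef → (ampliation k E X).PosSemidef) ∧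
       ∀ X, (E X).trace = X.trace}

/-- A finite-dimensional physical system: a Hamiltonian on the Hilbert space with
computational basis `ι`. The energy eigenbasis need not be the computational basis. -/
structure PhysSystem (ι : Type*) where
  H : Matrix ι ι ℂ
  hermitian : H.IsHermitian

/-- A spectral decomposition `H = ∑ x, energy x • |x⟩⟨x|` of the Hamiltonian, where the energy
eigenvectors `|x⟩` are the columns of the unitary matrix `V`. -/
structure EnergyBasis {ι : Type*} [Fintype ι] [DecidableEq ι] (A : PhysSystem ι) where
  energy : ι → ℝ
  V : Matrix ι ι ℂ
  unitary : V ∈ Matrix.unitaryGroup ι ℂ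
  spectral : A.H = V * Matrix.diagonal (fun x => (energy x : ℂ)) * Vᴴ

/-- The matrix of `M` in the energy eigenbasis, with entries `⟨x|M|x'⟩`. -/
def EnergyBasis.rep {ι : Type*} [Fintype ι] [DecidableEq ι] {A : PhysSystem ι}
    (e : EnergyBasis A) (M : Matrix ι ι ℂ) : Matrix ι ι ℂ :=
  e.Vᴴ * M * e.V

/-- The vector of diagonal elements `⟨x|M|x⟩` in the energy eigenbasis (these are real for the
Hermitian matrices `M` to which this is applied). -/
def EnergyBasis.diagVec {ι : Type*} [Fintype ι] [DecidableEq ι] {A : PhysSystem ι}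
    (e : EnergyBasis A) (M : Matrix ι ι ℂ) : ι → ℝ :=
  fun x => (e.rep M x x).re

/-- Relative non-degeneracy of two Hamiltonians with spectral decompositions `a`, `b`. -/
def RelativelyNondegenerate {ι κ : Type*} [Fintype ι] [DecidableEq ι] [Fintype κ]
    [DecidableEq κ] {A : PhysSystem ι} {B : PhysSystem κ}
    (a : EnergyBasis A) (b : EnergyBasis B) : Prop :=
  ∀ (x x' : ι) (y y' : κ),
    a.energy x - a.energy x' = b.energy y - b.energy y' → x = x' ∧ y = y'

/-- The Gibbs state `exp (-β H) / Tr exp (-β H)`. -/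
noncomputable def gibbs {ι : Type*} [Fintype ι] [DecidableEq ι] (β : ℝ) (A : PhysSystem ι) :
    Matrix ι ι ℂ :=
  (NormedSpace.exp (-(β : ℂ) • A.H)).trace⁻¹ • NormedSpace.exp (-(β : ℂ) • A.H)

/-- The time evolution `ρ ↦ exp (-i H t) ρ exp (i H t)`. -/
noncomputable def evolve {ι : Type*} [Fintype ι] [DecidableEq ι] (A : PhysSystem ι) (t : ℝ)
    (ρ : Matrix ι ι ℂ) : Matrix ι ι ℂ :=
  NormedSpace.exp (-(Complex.I * (t : ℂ)) • A.H) * ρ *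
    NormedSpace.exp ((Complex.I * (t : ℂ)) • A.H)

/-- Time-translation covariant channels. -/
def COV {ι κ : Type*} [Fintype ι] [DecidableEq ι] [Fintype κ] [DecidableEq κ]
    (A : PhysSystem ι) (B : PhysSystem κ) : Set (Matrix ι ι ℂ →ₗ[ℂ] Matrix κ κ ℂ) :=
  {E | E ∈ CPTP ι κ ∧
       ∀ (t : ℝ) (ρ : Matrix ι ι ℂ), IsDensity ρ → E (evolve A t ρ) = evolve B t (E ρ)}

/-- Gibbs preserving operations. -/
def GPO {ι κ : Type*} [Fintype ι] [DecidableEq ι] [Fintype κ] [DecidableEq κ] (β : ℝ)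
    (A : PhysSystem ι) (B : PhysSystem κ) : Set (Matrix ι ι ℂ →ₗ[ℂ] Matrix κ κ ℂ) :=
  {E | E ∈ CPTP ι κ ∧ E (gibbs β A) = gibbs β B}

/-- Gibbs preserving covariant operations. -/
def GPC {ι κ : Type*} [Fintype ι] [DecidableEq ι] [Fintype κ] [DecidableEq κ] (β : ℝ)
    (A : PhysSystem ι) (B : PhysSystem κ) : Set (Matrix ι ι ℂ →ₗ[ℂ] Matrix κ κ ℂ) :=
  GPO β A B ∩ COV A B

/-- Partial trace over the second tensor factor. -/
def traceSnd {κ δ : Type*} [Fintype δ] (M : Matrix (κ × δ) (κ × δ) ℂ) : Matrix κ κ ℂ :=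
  Matrix.of fun y y' => ∑ j, M (y, j) (y', j)

/-- Thermal operations from `A` to `B`: attach a finite-dimensional bath `R` in its Gibbs state,
apply a unitary `U` from `A R` onto `B S` that carries the joint Gibbs state of `A R` to the joint
Gibbs state of `B S`, and discard `S`. Such maps are automatically channels. -/
def TO {ι κ : Type*} [Fintype ι] [DecidableEq ι] [Fintype κ] [DecidableEq κ] (β : ℝ)
    (A : PhysSystem ι) (B : PhysSystem κ) : Set (Matrix ι ι ℂ →ₗ[ℂ] Matrix κ κ ℂ) :=
  {E | ∃ (d d' : ℕ) (_ : 0 < d) (_ : 0 < d') (R : PhysSystem (Fin d)) (S : PhysSystem (Fin d'))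
         (U : Matrix (κ × Fin d') (ι × Fin d) ℂ),
       Uᴴ * U = 1 ∧ U * Uᴴ = 1 ∧
       U * (gibbs β A ⊗ₖ gibbs β R) * Uᴴ = gibbs β B ⊗ₖ gibbs β S ∧
       ∀ X, E X = traceSnd (U * (X ⊗ₖ gibbs β R) * Uᴴ)}

/-- Closed thermal operations: channels that are limits of sequences of thermal operations.
Pointwise convergence is convergence in any norm, since the spaces are finite-dimensional. -/
def CTO {ι κ : Type*} [Fintype ι] [DecidableEq ι] [Fintype κ] [DecidableEq κ] (β : ℝ)
    (A : PhysSystem ι) (B : PhysSystem κ) : Set (Matrix ι ι ℂ →ₗ[ℂ] Matrix κ κ ℂ) :=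
  {E | E ∈ CPTP ι κ ∧
       ∃ Es : ℕ → (Matrix ι ι ℂ →ₗ[ℂ] Matrix κ κ ℂ),
         (∀ k, Es k ∈ TO β A B) ∧ ∀ X, Tendsto (fun k => Es k X) atTop (𝓝 (E X))}

/-- `(ρ, γ^A)` can be converted to `(σ, γ^B)` by the free operations `F` from `A` to `B`. -/
def Converts {ι κ : Type*} (F : Set (Matrix ι ι ℂ →ₗ[ℂ] Matrix κ κ ℂ))
    (ρ : Matrix ι ι ℂ) (σ : Matrix κ κ ℂ) : Prop :=
  ∃ E ∈ F, E ρ = σ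

/-- Relative majorization `(p, g) ≻ (q, h)`: a column stochastic matrix maps `p` to `q` and
`g` to `h`. -/
def RelMajorizes {ι κ : Type*} [Fintype ι] [Fintype κ] (p g : ι → ℝ) (q h : κ → ℝ) : Prop :=
  ∃ T : Matrix κ ι ℝ, (∀ y x, 0 ≤ T y x) ∧ (∀ x, ∑ y, T y x = 1) ∧
    q = T *ᵥ p ∧ h = T *ᵥ g

end Athermality

open Athermality

/-!
Everything is read in the energy eigenbases. For a linear map `E` let
`energyCoeff a b E x x' y y' = ⟨y|E(|x⟩⟨x'|)|y'⟩`.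

From operations to stochastic matrices: a covariant map multiplies this coefficient by two phases
rotating with the gaps `a_x - a_x'` and `b_y - b_y'`, so it vanishes unless the gaps agree, that is,
by relative non-degeneracy, unless `x = x'` and `y = y'` (`energyCoeff_eq_zero_of_COV`). For a
thermal operation the same holds because its unitary intertwines the joint Gibbs states and hence
only connects levels of equal joint weight (`energyCoeff_eq_zero_of_TO`), and this passes to limits.
A channel with this property measures the energy, applies a column stochastic matrix `T` to the
outcome and prepares an energy eigenstate: it is `classicalMap a b T`
(`exists_stochastic_of_energyCoeff`). Gibbs preservation becomes `T g^A = g^B`.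

From stochastic matrices to operations: `classicalMap a b T` is a covariant channel, and the point
is to approximate it by thermal operations (`classicalMap_mem_CTO`). Decoherence comes for free by
the first part, so that only the transition probabilities matter. The interaction is a permutation
of the levels of `A ⊗ B ⊗ P`, where `B ⊗ P` is the incoming and `A ⊗ P` the outgoing bath. The levels
of `P` are labelled by a box of exponents `k`, with Boltzmann weight the corresponding monomial `v k`
in the Gibbs probabilities of `A` and `B`, and with degeneracy `⌈N / v k⌉`, so that all levels of `P`
have nearly equal total weight. Then among the joint levels of a fixed interior label `k` about
`N g^A_x / v k` have first component `x` and about `N g^B_y / v k` have second component `y`.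
Since `T g^A = g^B`, there is room for `⌊N T_yx g^A_x / v k⌋` transitions from `x` to `y` within that
label, for all `x` and `y` at once (`exists_perm_transitionNumber`). The transition probabilities
are thus at least those of `T` up to a rounding error and the weight of the boundary of the box
(`exists_bath_perm`), both of which vanish as `N → ∞`; since columns sum to one, lower bounds suffice
for convergence (`tendsto_of_stochastic_of_le`).
-/

namespace Athermality

/-! ### Energy eigenbases -/

section EnergyLevels

variable {ι κ : Type*} [Fintype ι] [DecidableEq ι] [Fintype κ] [DecidableEq κ]

namespace EnergyBasis

variable {A : PhysSystem ι} (e : EnergyBasis A)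

lemma conjTranspose_V_mul_V : e.Vᴴ * e.V = 1 :=
  Matrix.mem_unitaryGroup_iff'.1 e.unitary

lemma V_mul_conjTranspose_V : e.V * e.Vᴴ = 1 :=
  Matrix.mem_unitaryGroup_iff.1 e.unitary

/-- The operator whose matrix in the energy eigenbasis is `M`; the inverse of `rep`. -/
def lift : Matrix ι ι ℂ →ₗ[ℂ] Matrix ι ι ℂ where
  toFun M := e.V * M * e.Vᴴ
  map_add' M N := by simp [mul_add, add_mul]
  map_smul' c M := by simp

lemma lift_apply (M : Matrix ι ι ℂ) : e.lift M = e.V * M * e.Vᴴ := rfl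

@[simp] lemma rep_lift (M : Matrix ι ι ℂ) : e.rep (e.lift M) = M := by
  rw [rep, lift_apply]
  calc e.Vᴴ * (e.V * M * e.Vᴴ) * e.V = (e.Vᴴ * e.V) * M * (e.Vᴴ * e.V) := by
        simp only [Matrix.mul_assoc]
    _ = M := by simp [conjTranspose_V_mul_V]

@[simp] lemma lift_rep (M : Matrix ι ι ℂ) : e.lift (e.rep M) = M := by
  rw [rep, lift_apply]
  calc e.V * (e.Vᴴ * M * e.V) * e.Vᴴ = (e.V * e.Vᴴ) * M * (e.V * e.Vᴴ) := by
        simp only [Matrix.mul_assoc]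
    _ = M := by simp [V_mul_conjTranspose_V]

lemma rep_injective : Function.Injective e.rep :=
  Function.LeftInverse.injective e.lift_rep

lemma lift_mul (M N : Matrix ι ι ℂ) : e.lift (M * N) = e.lift M * e.lift N := by
  apply e.rep_injective
  rw [rep_lift, rep, lift_apply, lift_apply]
  calc M * N = (e.Vᴴ * e.V) * M * (e.Vᴴ * e.V) * N * (e.Vᴴ * e.V) := by
        simp [conjTranspose_V_mul_V]
    _ = _ := by simp only [Matrix.mul_assoc]

lemma trace_lift (M : Matrix ι ι ℂ) : (e.lift M).trace = M.trace := by
  rw [lift_apply, Matrix.trace_mul_comm, ← Matrix.mul_assoc, conjTranspose_V_mul_V, one_mul]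

lemma trace_rep (M : Matrix ι ι ℂ) : (e.rep M).trace = M.trace := by
  rw [← e.trace_lift, lift_rep]

lemma rep_conjTranspose (M : Matrix ι ι ℂ) : (e.rep M)ᴴ = e.rep Mᴴ := by
  simp [rep, Matrix.mul_assoc]

lemma exp_smul_H (c : ℂ) :
    NormedSpace.exp (c • A.H) = e.lift (diagonal fun x => Complex.exp (c * e.energy x)) := by
  have hinv : e.V⁻¹ = e.Vᴴ := Matrix.inv_eq_left_inv e.conjTranspose_V_mul_V
  have hu : IsUnit e.V := (Matrix.isUnit_iff_isUnit_det _).2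
    (Matrix.isUnit_det_of_left_inverse e.conjTranspose_V_mul_V)
  have h : c • A.H = e.V * diagonal (fun x => c * (e.energy x : ℂ)) * e.V⁻¹ := by
    rw [e.spectral, hinv]
    have : diagonal (fun x => c * (e.energy x : ℂ)) = c • diagonal (fun x => (e.energy x : ℂ)) := by
      ext i j; by_cases hij : i = j <;> simp [hij]
    rw [this]; simp
  rw [h, Matrix.exp_conj _ _ hu, Matrix.exp_diagonal, hinv, lift_apply]
  congr 3
  ext x
  rw [Pi.coe_exp, Complex.exp_eq_exp_ℂ]

/-- The Gibbs probability of an energy level. -/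
noncomputable def gibbsWeight (β : ℝ) (x : ι) : ℝ :=
  Real.exp (-β * e.energy x) / ∑ x', Real.exp (-β * e.energy x')

lemma sum_exp_pos [Nonempty ι] (β : ℝ) : 0 < ∑ x', Real.exp (-β * e.energy x') :=
  Finset.sum_pos (fun _ _ => Real.exp_pos _) Finset.univ_nonempty

lemma gibbsWeight_pos [Nonempty ι] (β : ℝ) (x : ι) : 0 < e.gibbsWeight β x :=
  div_pos (Real.exp_pos _) (e.sum_exp_pos β)

lemma sum_gibbsWeight [Nonempty ι] (β : ℝ) : ∑ x, e.gibbsWeight β x = 1 := by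
  simp only [gibbsWeight]
  rw [← Finset.sum_div, div_self (e.sum_exp_pos β).ne']

lemma gibbs_eq_lift (β : ℝ) :
    gibbs β A = e.lift (diagonal fun x => (e.gibbsWeight β x : ℂ)) := by
  rw [gibbs, e.exp_smul_H, trace_lift, Matrix.trace_diagonal, ← map_smul]
  congr 1
  ext i j
  by_cases hij : i = j
  · subst hij
    simp [gibbsWeight, div_eq_inv_mul]
  · simp [hij]

lemma rep_gibbs (β : ℝ) : e.rep (gibbs β A) = diagonal fun x => (e.gibbsWeight β x : ℂ) := by
  rw [gibbs_eq_lift, rep_lift]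

lemma diagVec_gibbs (β : ℝ) : e.diagVec (gibbs β A) = e.gibbsWeight β := by
  ext x
  simp [diagVec, rep_gibbs]

lemma rep_evolve (t : ℝ) (M : Matrix ι ι ℂ) (x x' : ι) :
    e.rep (evolve A t M) x x' =
      Complex.exp (-(Complex.I * t) * (e.energy x - e.energy x')) * e.rep M x x' := by
  conv_lhs => rw [← e.lift_rep M]
  rw [evolve, e.exp_smul_H, e.exp_smul_H, ← lift_mul, ← lift_mul, rep_lift,
    Matrix.mul_diagonal, Matrix.diagonal_mul, mul_sub, sub_eq_add_neg, Complex.exp_add]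
  ring_nf

lemma rep_apply_self_eq_diagVec {M : Matrix ι ι ℂ} (hM : M.IsHermitian) (x : ι) :
    e.rep M x x = (e.diagVec M x : ℂ) := by
  have h : (e.rep M).IsHermitian := by
    rw [Matrix.IsHermitian, rep_conjTranspose, hM.eq]
  exact (Complex.conj_eq_iff_re.1 (h.apply x x)).symm

end EnergyBasis

lemma gibbs_isHermitian {A : PhysSystem ι} (e : EnergyBasis A) (β : ℝ) :
    (gibbs β A).IsHermitian := by
  rw [e.gibbs_eq_lift, e.lift_apply]
  apply Matrix.isHermitian_mul_mul_conjTranspose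
  rw [Matrix.isHermitian_diagonal_iff]
  intro x
  exact Complex.conj_ofReal _

/-! ### Maps that act classically on energy levels -/

variable {A : PhysSystem ι} {B : PhysSystem κ} (a : EnergyBasis A) (b : EnergyBasis B)

/-- The map that measures in the energy eigenbasis of `A`, processes the outcome by the matrix
`t` of transition coefficients, and prepares an energy eigenstate of `B`. -/
def classicalMap (t : Matrix κ ι ℂ) : Matrix ι ι ℂ →ₗ[ℂ] Matrix κ κ ℂ where
  toFun X := b.lift (diagonal (t *ᵥ fun x => a.rep X x x))
  map_add' X Y := by
    rw [← map_add]
    congr 1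
    ext i j
    by_cases hij : i = j
    · subst hij
      simp [EnergyBasis.rep, Matrix.mulVec, dotProduct, mul_add, add_mul, Finset.sum_add_distrib]
    · simp [hij]
  map_smul' c X := by
    rw [RingHom.id_apply, ← map_smul]
    congr 1
    ext i j
    by_cases hij : i = j
    · subst hij
      simp [EnergyBasis.rep, Matrix.mulVec, dotProduct, Finset.mul_sum, mul_left_comm]
    · simp [hij]

lemma classicalMap_apply (t : Matrix κ ι ℂ) (X : Matrix ι ι ℂ) :
    classicalMap a b t X = b.lift (diagonal (t *ᵥ fun x => a.rep X x x)) := rfl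

/-- The entry `⟨y|E(|x⟩⟨x'|)|y'⟩` of a linear map in the energy eigenbases. -/
def energyCoeff (E : Matrix ι ι ℂ →ₗ[ℂ] Matrix κ κ ℂ) (x x' : ι) (y y' : κ) : ℂ :=
  b.rep (E (a.lift (Matrix.single x x' 1))) y y'

lemma rep_map_apply (E : Matrix ι ι ℂ →ₗ[ℂ] Matrix κ κ ℂ) (X : Matrix ι ι ℂ) (y y' : κ) :
    b.rep (E X) y y' = ∑ x, ∑ x', a.rep X x x' * energyCoeff a b E x x' y y' := by
  conv_lhs => rw [← a.lift_rep X, Matrix.matrix_eq_sum_single (a.rep X)]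
  have h : ∀ x x', Matrix.single x x' (a.rep X x x')
      = a.rep X x x' • (Matrix.single x x' 1 : Matrix ι ι ℂ) := by
    intro x x'; simp
  simp only [map_sum, h, map_smul]
  simp only [EnergyBasis.rep, Matrix.mul_sum, Matrix.sum_mul, Matrix.sum_apply, energyCoeff,
    Matrix.mul_smul, Matrix.smul_mul, Matrix.smul_apply, smul_eq_mul]

lemma eq_classicalMap {E : Matrix ι ι ℂ →ₗ[ℂ] Matrix κ κ ℂ}
    (h : ∀ x x' y y', ¬ (x = x' ∧ y = y') → energyCoeff a b E x x' y y' = 0) :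
    E = classicalMap a b (Matrix.of fun y x => energyCoeff a b E x x y y) := by
  apply LinearMap.ext
  intro X
  apply b.rep_injective
  rw [classicalMap_apply, b.rep_lift]
  ext y y'
  rw [rep_map_apply a b]
  have h1 : ∀ x, ∑ x', a.rep X x x' * energyCoeff a b E x x' y y'
      = a.rep X x x * energyCoeff a b E x x y y' := by
    intro x
    refine Finset.sum_eq_single x (fun x' _ hx' => ?_) (by simp)
    rw [h x x' y y' (fun hh => hx' hh.1.symm), mul_zero]
  simp only [h1]
  by_cases hy : y = y'
  · subst hy
    simp [Matrix.mulVec, dotProduct, mul_comm]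
  · rw [diagonal_apply_ne _ hy]
    refine Finset.sum_eq_zero fun x _ => ?_
    rw [h x x y y' (fun hh => hy hh.2), mul_zero]

/-- A classical processing of energy outcomes converts `M` into `N` as soon as it does so on the
level of the diagonals, provided `N` has no coherence between energy levels. -/
lemma classicalMap_eq_of_diagVec {M : Matrix ι ι ℂ} {N : Matrix κ κ ℂ} (hM : M.IsHermitian)
    (hN : N.IsHermitian) (hdiag : (b.rep N).IsDiag) {T : Matrix κ ι ℝ}
    (hT : b.diagVec N = T *ᵥ a.diagVec M) :
    classicalMap a b (T.map Complex.ofReal) M = N := by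
  apply b.rep_injective
  rw [classicalMap_apply, b.rep_lift]
  ext y y'
  by_cases hy : y = y'
  · subst hy
    rw [diagonal_apply_eq, b.rep_apply_self_eq_diagVec hN, hT]
    simp [Matrix.mulVec, dotProduct, a.rep_apply_self_eq_diagVec hM]
  · rw [diagonal_apply_ne _ hy]
    exact (hdiag hy).symm

/-- A Kraus decomposition of a map ampliates block by block. -/
lemma ampliation_of_eq_sum {ι κ α : Type*} [Fintype ι] (s : Finset α)
    (E : Matrix ι ι ℂ →ₗ[ℂ] Matrix κ κ ℂ)
    (K : α → Matrix κ ι ℂ) (hE : ∀ X, E X = ∑ i ∈ s, K i * X * (K i)ᴴ) (k : ℕ)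
    (X : Matrix (Fin k × ι) (Fin k × ι) ℂ) :
    ampliation k E X = ∑ i ∈ s, ((1 : Matrix (Fin k) (Fin k) ℂ) ⊗ₖ K i) * X *
      ((1 : Matrix (Fin k) (Fin k) ℂ) ⊗ₖ K i)ᴴ := by
  ext ⟨u, p⟩ ⟨v, q⟩
  simp only [ampliation, hE, Matrix.sum_apply, Matrix.of_apply]
  refine Finset.sum_congr rfl fun i _ => ?_
  simp [Matrix.mul_apply, Fintype.sum_prod_type, Matrix.kroneckerMap_apply, Matrix.one_apply,
    apply_ite, ite_mul]

/-- Maps with a Kraus decomposition are completely positive. -/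
lemma posSemidef_ampliation_of_eq_sum {ι κ α : Type*} [Fintype ι] [Fintype κ] (s : Finset α)
    (E : Matrix ι ι ℂ →ₗ[ℂ] Matrix κ κ ℂ)
    (K : α → Matrix κ ι ℂ) (hE : ∀ X, E X = ∑ i ∈ s, K i * X * (K i)ᴴ) (k : ℕ)
    (X : Matrix (Fin k × ι) (Fin k × ι) ℂ) (hX : X.PosSemidef) :
    (ampliation k E X).PosSemidef := by
  rw [ampliation_of_eq_sum s E K hE]
  exact Matrix.posSemidef_sum s fun i _ => hX.mul_mul_conjTranspose_same _

lemma classicalMap_mem_CPTP {T : Matrix κ ι ℝ} (h0 : ∀ y x, 0 ≤ T y x)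
    (h1 : ∀ x, ∑ y, T y x = 1) : classicalMap a b (T.map Complex.ofReal) ∈ CPTP ι κ := by
  constructor
  · -- The Kraus operators are `√(T y x) |y⟩⟨x|`.
    refine posSemidef_ampliation_of_eq_sum (Finset.univ : Finset (κ × ι)) _
      (fun i => b.V * Matrix.single i.1 i.2 (Real.sqrt (T i.1 i.2) : ℂ) * a.Vᴴ) fun X => ?_
    have h : ∀ i : κ × ι, b.V * Matrix.single i.1 i.2 (Real.sqrt (T i.1 i.2) : ℂ) * a.Vᴴ * X *
        (b.V * Matrix.single i.1 i.2 (Real.sqrt (T i.1 i.2) : ℂ) * a.Vᴴ)ᴴ =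
        b.lift (Matrix.single i.1 i.1 (T i.1 i.2 * a.rep X i.2 i.2 : ℂ)) := by
      rintro ⟨y, x⟩
      have h2 : Matrix.single y x (Real.sqrt (T y x) : ℂ) * a.rep X *
          (Matrix.single y x (Real.sqrt (T y x) : ℂ))ᴴ =
          Matrix.single y y (T y x * a.rep X x x : ℂ) := by
        rw [Matrix.conjTranspose_single, Matrix.single_mul_mul_single]
        congr 1
        rw [RCLike.star_def, Complex.conj_ofReal, mul_right_comm, ← Complex.ofReal_mul,
          Real.mul_self_sqrt (h0 y x)]
      rw [← h2, b.lift_apply, EnergyBasis.rep]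
      simp only [Matrix.conjTranspose_mul, Matrix.conjTranspose_conjTranspose, Matrix.mul_assoc]
    simp only [h]
    rw [← map_sum, classicalMap_apply, Fintype.sum_prod_type]
    congr 1
    ext y y'
    simp only [Matrix.sum_apply, Matrix.single_apply]
    by_cases hy : y = y'
    · subst hy
      simp [Matrix.mulVec, dotProduct]
    · rw [diagonal_apply_ne _ hy, eq_comm]
      refine Finset.sum_eq_zero fun z _ => Finset.sum_eq_zero fun x _ => if_neg ?_
      rintro ⟨rfl, rfl⟩
      exact hy rfl
  · intro X
    rw [classicalMap_apply, b.trace_lift, ← a.trace_rep X, Matrix.trace_diagonal]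
    simp only [Matrix.mulVec, dotProduct]
    rw [Finset.sum_comm, Matrix.trace]
    refine Finset.sum_congr rfl fun x _ => ?_
    rw [← Finset.sum_mul]
    simp only [Matrix.map_apply, Matrix.diag_apply]
    rw [← Complex.ofReal_sum, h1]
    simp

lemma classicalMap_mem_COV {t : Matrix κ ι ℂ} (h : classicalMap a b t ∈ CPTP ι κ) :
    classicalMap a b t ∈ COV A B := by
  refine ⟨h, fun s ρ _ => ?_⟩
  apply b.rep_injective
  ext y y'
  rw [b.rep_evolve, classicalMap_apply, classicalMap_apply, b.rep_lift, b.rep_lift]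
  by_cases hy : y = y'
  · subst hy
    simp [a.rep_evolve]
  · simp [hy]

/-! ### Covariant maps -/

/-- Linear maps that agree on density matrices agree everywhere, by polarization. -/
lemma linearMap_ext_of_isDensity {ι κ : Type*} [Fintype ι] [DecidableEq ι]
    {E F : Matrix ι ι ℂ →ₗ[ℂ] Matrix κ κ ℂ}
    (h : ∀ ρ, IsDensity ρ → E ρ = F ρ) : E = F := by
  have h1 : ∀ v : ι → ℂ, E (Matrix.vecMulVec v (star v)) = F (Matrix.vecMulVec v (star v)) := by
    intro v
    by_cases hv : v = 0
    · simp [hv]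
    have hp := Matrix.posSemidef_vecMulVec_self_star v
    set c : ℂ := (Matrix.vecMulVec v (star v)).trace with hc
    have hc0 : c ≠ 0 := by
      rw [hc, Matrix.trace_vecMulVec]
      simpa using hv
    have hd : IsDensity (c⁻¹ • Matrix.vecMulVec v (star v)) := by
      refine ⟨hp.smul ?_, ?_⟩
      · exact inv_nonneg.2 hp.trace_nonneg
      · rw [Matrix.trace_smul, ← hc, smul_eq_mul, inv_mul_cancel₀ hc0]
    have := h _ hd
    rw [map_smul, map_smul] at this
    exact smul_right_injective _ (inv_ne_zero hc0) this
  have h2 : ∀ v w : ι → ℂ, Matrix.vecMulVec v (star w) = (4 : ℂ)⁻¹ •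
      (Matrix.vecMulVec (v + w) (star (v + w)) - Matrix.vecMulVec (v - w) (star (v - w))
      + Complex.I • Matrix.vecMulVec (v + Complex.I • w) (star (v + Complex.I • w))
      - Complex.I • Matrix.vecMulVec (v - Complex.I • w) (star (v - Complex.I • w))) := by
    intro v w
    ext i j
    simp [Matrix.vecMulVec_apply]
    ring_nf
    simp only [Complex.I_sq]
    ring
  apply Matrix.ext_linearMap
  intro i j
  apply LinearMap.ext_ring
  have h3 : Matrix.single i j (1 : ℂ) = Matrix.vecMulVec (Pi.single i 1) (star (Pi.single j 1)) := by
    ext k l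
    simp [Matrix.vecMulVec_apply, Matrix.single_apply, Pi.single_apply, eq_comm, ite_and]
    by_cases hi : i = k <;> by_cases hj : j = l <;> simp [hi, hj]
  simp only [LinearMap.comp_apply, Matrix.singleLinearMap_apply]
  rw [h3, h2]
  simp only [map_smul, map_sub, map_add, h1]

/-- Time evolution as a linear map. -/
noncomputable def evolveLinear (A : PhysSystem ι) (t : ℝ) : Matrix ι ι ℂ →ₗ[ℂ] Matrix ι ι ℂ where
  toFun := evolve A t
  map_add' M N := by simp [evolve, mul_add, add_mul]
  map_smul' c M := by simp [evolve]

/-- A covariant map multiplies the transition coefficients by matching phases, so that those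
between different energy gaps vanish. -/
lemma energyCoeff_eq_zero_of_COV (hab : RelativelyNondegenerate a b)
    {E : Matrix ι ι ℂ →ₗ[ℂ] Matrix κ κ ℂ} (hE : E ∈ COV A B) (x x' : ι) (y y' : κ)
    (h : ¬ (x = x' ∧ y = y')) : energyCoeff a b E x x' y y' = 0 := by
  set δ : ℝ := (a.energy x - a.energy x') - (b.energy y - b.energy y') with hδ
  have hδ0 : δ ≠ 0 := fun h0 => h (hab x x' y y' (sub_eq_zero.1 h0))
  -- At time `π / δ` the two phases are opposite.
  set t : ℝ := Real.pi / δ with ht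
  have hcov : E ∘ₗ evolveLinear A t = evolveLinear B t ∘ₗ E :=
    linearMap_ext_of_isDensity fun ρ hρ => hE.2 t ρ hρ
  have hev : evolve A t (a.lift (Matrix.single x x' 1)) =
      Complex.exp (-(Complex.I * t) * (a.energy x - a.energy x')) •
        a.lift (Matrix.single x x' 1) := by
    apply a.rep_injective
    ext i j
    rw [a.rep_evolve, ← map_smul, a.rep_lift, a.rep_lift, Matrix.smul_apply]
    by_cases hij : x = i ∧ x' = j
    · rw [hij.1, hij.2]; simp
    · simp [hij]
  have h1 := LinearMap.congr_fun hcov (a.lift (Matrix.single x x' 1))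
  change E (evolve A t _) = evolve B t (E _) at h1
  rw [hev, map_smul] at h1
  have h2 := congrArg (fun M => b.rep M y y') h1
  simp only [b.rep_evolve] at h2
  have h3 : ∀ (c : ℂ) (M : Matrix κ κ ℂ), b.rep (c • M) y y' = c * b.rep M y y' := by
    intro c M; simp [EnergyBasis.rep]
  rw [h3] at h2
  change _ * energyCoeff a b E x x' y y' = _ * energyCoeff a b E x x' y y' at h2
  have h4 : Complex.exp (-(Complex.I * t) * (a.energy x - a.energy x')) =
      - Complex.exp (-(Complex.I * t) * (b.energy y - b.energy y')) := by
    have : -(Complex.I * t) * ((a.energy x : ℂ) - a.energy x') =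
        -(Complex.I * t) * (b.energy y - b.energy y') - Real.pi * Complex.I := by
      have e1 : (a.energy x : ℂ) - a.energy x' = (b.energy y - b.energy y') + δ := by
        rw [hδ]; push_cast; ring
      have e2 : (t : ℂ) * δ = Real.pi := by
        rw [ht]; push_cast
        exact div_mul_cancel₀ _ (by exact_mod_cast hδ0)
      rw [e1, mul_add, ← e2]; ring
    rw [this, Complex.exp_sub, Complex.exp_pi_mul_I]
    ring
  rw [h4, neg_mul, neg_eq_iff_add_eq_zero, ← two_mul] at h2
  simpa [Complex.exp_ne_zero] using h2

/-- A channel that acts classically on energy levels acts by a column stochastic matrix. -/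
lemma exists_stochastic_of_energyCoeff {E : Matrix ι ι ℂ →ₗ[ℂ] Matrix κ κ ℂ} (hE : E ∈ CPTP ι κ)
    (h : ∀ x x' y y', ¬ (x = x' ∧ y = y') → energyCoeff a b E x x' y y' = 0) :
    ∃ T : Matrix κ ι ℝ, (∀ y x, 0 ≤ T y x) ∧ (∀ x, ∑ y, T y x = 1) ∧
      E = classicalMap a b (T.map Complex.ofReal) := by
  have hpos : ∀ x y, 0 ≤ energyCoeff a b E x x y y := by
    intro x y
    have h1 : (a.lift (Matrix.single x x 1)).PosSemidef := by
      rw [a.lift_apply]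
      refine Matrix.PosSemidef.mul_mul_conjTranspose_same ?_ _
      rw [← Matrix.diagonal_single]
      refine Matrix.PosSemidef.diagonal ?_
      intro i
      by_cases hi : i = x
      · subst hi; simp
      · simp [hi]
    have h2 := hE.1 1 _ (h1.submatrix (Prod.snd : Fin 1 × ι → ι))
    have h3 := (h2.submatrix (fun y : κ => ((0 : Fin 1), y))).conjTranspose_mul_mul_same b.V
    exact h3.diag_nonneg (i := y)
  refine ⟨Matrix.of fun y x => (energyCoeff a b E x x y y).re,
    fun y x => (Complex.le_def.1 (hpos x y)).1, fun x => ?_, ?_⟩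
  · have h1 : (b.rep (E (a.lift (Matrix.single x x 1)))).trace = 1 := by
      rw [b.trace_rep, hE.2, a.trace_lift, Matrix.trace_single_eq_same]
    have h2 := congrArg Complex.re h1
    rwa [Matrix.trace, Complex.re_sum] at h2
  · conv_lhs => rw [eq_classicalMap a b h]
    congr 1
    ext y x
    simp only [Matrix.map_apply, Matrix.of_apply]
    exact Complex.ext rfl (Complex.le_def.1 (hpos x y)).2.symm

end EnergyLevels

/-! ### Thermal operations and relative non-degeneracy -/

section ThermalOperations

variable {ι κ : Type*} [Fintype ι] [DecidableEq ι] [Fintype κ] [DecidableEq κ]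

/-- The spectral theorem provides every system with an energy eigenbasis. -/
lemma nonempty_energyBasis (A : PhysSystem ι) : Nonempty (EnergyBasis A) :=
  ⟨{ energy := A.hermitian.eigenvalues
     V := A.hermitian.eigenvectorUnitary
     unitary := A.hermitian.eigenvectorUnitary.2
     spectral := by
      have h := A.hermitian.spectral_theorem
      rw [Unitary.conjStarAlgAut_apply] at h
      exact h }⟩

/-- A local unitary on the discarded factor is invisible, and a local operator on the other factor
can be pulled out of the partial trace. -/
lemma traceSnd_conj_kronecker {κ δ : Type*} [Fintype κ] [Fintype δ] [DecidableEq δ] (V : Matrix κ κ ℂ)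
    {W : Matrix δ δ ℂ} (hW : Wᴴ * W = 1) (M : Matrix (κ × δ) (κ × δ) ℂ) :
    traceSnd ((V ⊗ₖ W) * M * (V ⊗ₖ W)ᴴ) = V * traceSnd M * Vᴴ := by
  have hW' : ∀ s s', ∑ j, W j s * star (W j s') = if s = s' then 1 else 0 := by
    intro s s'
    have := congrFun (congrFun hW s') s
    rw [Matrix.mul_apply, Matrix.one_apply] at this
    simp only [Matrix.conjTranspose_apply, eq_comm (a := s')] at this
    rw [← this]
    exact Finset.sum_congr rfl fun j _ => mul_comm _ _
  ext y y'
  have h : ∀ j, ((V ⊗ₖ W) * M * (V ⊗ₖ W)ᴴ) (y, j) (y', j) =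
      ∑ z', ∑ s', ∑ z, ∑ s, (V y z * M (z, s) (z', s') * star (V y' z')) *
        (W j s * star (W j s')) := by
    intro j
    simp only [Matrix.mul_apply, Fintype.sum_prod_type, Matrix.kroneckerMap_apply,
      Matrix.conjTranspose_apply, Finset.sum_mul, star_mul']
    refine Finset.sum_congr rfl fun _ _ => Finset.sum_congr rfl fun _ _ =>
      Finset.sum_congr rfl fun _ _ => Finset.sum_congr rfl fun _ _ => ?_
    ring
  simp only [traceSnd, Matrix.of_apply, h]
  rw [Finset.sum_comm]
  simp only [Matrix.mul_apply, Matrix.of_apply, Matrix.conjTranspose_apply]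
  refine Finset.sum_congr rfl fun z' _ => ?_
  rw [Finset.sum_comm, Finset.sum_mul]
  simp only [Finset.mul_sum, Finset.sum_mul]
  have h2 : ∀ s', ∑ j, ∑ z, ∑ s, V y z * M (z, s) (z', s') * star (V y' z') *
      (W j s * star (W j s')) = ∑ z, V y z * M (z, s') (z', s') * star (V y' z') := by
    intro s'
    rw [Finset.sum_comm]
    refine Finset.sum_congr rfl fun z _ => ?_
    rw [Finset.sum_comm]
    simp only [← Finset.mul_sum, hW']
    simp
  simp only [h2]
  exact Finset.sum_comm

variable {A : PhysSystem ι} {B : PhysSystem κ} (a : EnergyBasis A) (b : EnergyBasis B)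

lemma EnergyBasis.lift_kronecker_lift {δ : Type*} [Fintype δ] [DecidableEq δ] {R : PhysSystem δ}
    (r : EnergyBasis R) (M : Matrix ι ι ℂ) (N : Matrix δ δ ℂ) :
    a.lift M ⊗ₖ r.lift N = (a.V ⊗ₖ r.V) * (M ⊗ₖ N) * (a.V ⊗ₖ r.V)ᴴ := by
  rw [a.lift_apply, r.lift_apply, Matrix.conjTranspose_kronecker, Matrix.mul_kronecker_mul,
    Matrix.mul_kronecker_mul]

lemma EnergyBasis.kronecker_conjTranspose_mul {δ : Type*} [Fintype δ] [DecidableEq δ]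
    {R : PhysSystem δ} (r : EnergyBasis R) : (a.V ⊗ₖ r.V)ᴴ * (a.V ⊗ₖ r.V) = 1 := by
  rw [Matrix.conjTranspose_kronecker, ← Matrix.mul_kronecker_mul, a.conjTranspose_V_mul_V,
    r.conjTranspose_V_mul_V, Matrix.one_kronecker_one]

lemma EnergyBasis.kronecker_mul_conjTranspose {δ : Type*} [Fintype δ] [DecidableEq δ]
    {R : PhysSystem δ} (r : EnergyBasis R) : (a.V ⊗ₖ r.V) * (a.V ⊗ₖ r.V)ᴴ = 1 := by
  rw [Matrix.conjTranspose_kronecker, ← Matrix.mul_kronecker_mul, a.V_mul_conjTranspose_V,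
    r.V_mul_conjTranspose_V, Matrix.one_kronecker_one]

/-- The output of a bath interaction, where `W` is the matrix of the interaction in the energy
eigenbases. -/
lemma rep_traceSnd_interaction {δ δ' : Type*} [Fintype δ] [DecidableEq δ] [Fintype δ']
    [DecidableEq δ'] {R : PhysSystem δ} {S : PhysSystem δ'} (r : EnergyBasis R)
    (s : EnergyBasis S) (W : Matrix (κ × δ') (ι × δ) ℂ) (M : Matrix ι ι ℂ) (N : Matrix δ δ ℂ) :
    b.rep (traceSnd (((b.V ⊗ₖ s.V) * W * (a.V ⊗ₖ r.V)ᴴ) * (a.lift M ⊗ₖ r.lift N) *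
      ((b.V ⊗ₖ s.V) * W * (a.V ⊗ₖ r.V)ᴴ)ᴴ)) = traceSnd (W * (M ⊗ₖ N) * Wᴴ) := by
  have h : ((b.V ⊗ₖ s.V) * W * (a.V ⊗ₖ r.V)ᴴ) * (a.lift M ⊗ₖ r.lift N) *
      ((b.V ⊗ₖ s.V) * W * (a.V ⊗ₖ r.V)ᴴ)ᴴ =
      (b.V ⊗ₖ s.V) * (W * (M ⊗ₖ N) * Wᴴ) * (b.V ⊗ₖ s.V)ᴴ := by
    rw [a.lift_kronecker_lift r]
    calc _ = (b.V ⊗ₖ s.V) * (W * (((a.V ⊗ₖ r.V)ᴴ * (a.V ⊗ₖ r.V)) * (M ⊗ₖ N) *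
          ((a.V ⊗ₖ r.V)ᴴ * (a.V ⊗ₖ r.V))) * Wᴴ) * (b.V ⊗ₖ s.V)ᴴ := by
          simp only [Matrix.conjTranspose_mul, Matrix.conjTranspose_conjTranspose,
            Matrix.mul_assoc]
      _ = _ := by rw [a.kronecker_conjTranspose_mul r, Matrix.one_mul, Matrix.mul_one]
  rw [h, traceSnd_conj_kronecker _ s.conjTranspose_V_mul_V, ← b.lift_apply, b.rep_lift]

lemma traceSnd_single_kronecker_diagonal {κ δ δ' : Type*} [Fintype δ] [DecidableEq δ] [Fintype δ']
    (W : Matrix (κ × δ') (ι × δ) ℂ) (g : δ → ℂ) (x x' : ι) (y y' : κ) :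
    traceSnd (W * (Matrix.single x x' 1 ⊗ₖ diagonal g) * Wᴴ) y y' =
      ∑ j, ∑ i, W (y, j) (x, i) * g i * star (W (y', j) (x', i)) := by
  simp only [traceSnd, Matrix.of_apply]
  refine Finset.sum_congr rfl fun j _ => ?_
  simp only [Matrix.mul_apply, Matrix.kroneckerMap_apply, Fintype.sum_prod_type,
    Matrix.conjTranspose_apply, Matrix.single_apply, Matrix.diagonal_apply]
  rw [Finset.sum_eq_single x' (fun z _ hz => Finset.sum_eq_zero fun i _ => by
    simp [hz.symm]) (by simp)]
  refine Finset.sum_congr rfl fun i _ => ?_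
  rw [Finset.sum_eq_single x (fun z _ hz => by simp [hz.symm]) (by simp)]
  simp

lemma EnergyBasis.energy_sub_eq_of_gibbsWeight [Nonempty ι] [Nonempty κ] {β : ℝ} (hβ : β ≠ 0)
    {x x' : ι} {y y' : κ} {c c' : ℝ} (hc : c ≠ 0)
    (h : a.gibbsWeight β x * c = b.gibbsWeight β y * c')
    (h' : a.gibbsWeight β x' * c = b.gibbsWeight β y' * c') :
    a.energy x - a.energy x' = b.energy y - b.energy y' := by
  have hx := (a.gibbsWeight_pos β x).ne'
  have hc' : c' ≠ 0 := by
    rintro rfl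
    rw [mul_zero] at h
    exact mul_ne_zero hx hc h
  have h1 : a.gibbsWeight β x * b.gibbsWeight β y' = a.gibbsWeight β x' * b.gibbsWeight β y := by
    apply mul_right_cancel₀ (mul_ne_zero hc hc')
    linear_combination (b.gibbsWeight β y' * c') * h - (b.gibbsWeight β y * c') * h'
  have hA := (a.sum_exp_pos β).ne'
  have hB := (b.sum_exp_pos β).ne'
  simp only [gibbsWeight, div_mul_div_comm] at h1
  rw [div_left_inj' (mul_ne_zero hA hB), ← Real.exp_add, ← Real.exp_add] at h1
  have h2 := Real.exp_injective h1
  apply mul_left_cancel₀ hβ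
  linear_combination -h2

/-- The unitary of a thermal operation only connects levels of equal joint Gibbs weight, so that
coherences between different energy gaps are destroyed when the bath is traced out. -/
lemma energyCoeff_eq_zero_of_TO [Nonempty ι] [Nonempty κ] {β : ℝ} (hβ : β ≠ 0)
    (hab : RelativelyNondegenerate a b) {E : Matrix ι ι ℂ →ₗ[ℂ] Matrix κ κ ℂ} (hE : E ∈ TO β A B)
    (x x' : ι) (y y' : κ) (h : ¬ (x = x' ∧ y = y')) : energyCoeff a b E x x' y y' = 0 := by
  obtain ⟨d, d', hd, hd', R, S, U, hU, hU', hgibbs, hEU⟩ := hE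
  have : Nonempty (Fin d) := ⟨⟨0, hd⟩⟩
  obtain ⟨r⟩ := nonempty_energyBasis R
  obtain ⟨s⟩ := nonempty_energyBasis S
  set W := (b.V ⊗ₖ s.V)ᴴ * U * (a.V ⊗ₖ r.V) with hW
  have hUW : U = (b.V ⊗ₖ s.V) * W * (a.V ⊗ₖ r.V)ᴴ := by
    calc U = ((b.V ⊗ₖ s.V) * (b.V ⊗ₖ s.V)ᴴ) * U * ((a.V ⊗ₖ r.V) * (a.V ⊗ₖ r.V)ᴴ) := by
          rw [a.kronecker_mul_conjTranspose r, b.kronecker_mul_conjTranspose s, Matrix.one_mul, Matrix.mul_one]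
      _ = _ := by rw [hW]; simp only [Matrix.mul_assoc]
  have hint : U * (gibbs β A ⊗ₖ gibbs β R) = (gibbs β B ⊗ₖ gibbs β S) * U := by
    rw [← hgibbs, Matrix.mul_assoc _ Uᴴ, hU, Matrix.mul_one]
  have hWint : W * diagonal (fun i : ι × Fin d => (a.gibbsWeight β i.1 * r.gibbsWeight β i.2 : ℂ))
      = diagonal (fun i : κ × Fin d' => (b.gibbsWeight β i.1 * s.gibbsWeight β i.2 : ℂ)) * W := by
    rw [a.gibbs_eq_lift, b.gibbs_eq_lift, r.gibbs_eq_lift, s.gibbs_eq_lift,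
      a.lift_kronecker_lift r, b.lift_kronecker_lift s, Matrix.diagonal_kronecker_diagonal,
      Matrix.diagonal_kronecker_diagonal] at hint
    have h1 := congrArg (fun M => (b.V ⊗ₖ s.V)ᴴ * M * (a.V ⊗ₖ r.V)) hint
    simp only at h1
    set DA := diagonal (fun i : ι × Fin d => (a.gibbsWeight β i.1 * r.gibbsWeight β i.2 : ℂ))
    set DB := diagonal (fun i : κ × Fin d' => (b.gibbsWeight β i.1 * s.gibbsWeight β i.2 : ℂ))
    calc W * DA = W * DA * ((a.V ⊗ₖ r.V)ᴴ * (a.V ⊗ₖ r.V)) := by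
          rw [a.kronecker_conjTranspose_mul r, Matrix.mul_one]
      _ = (b.V ⊗ₖ s.V)ᴴ * (U * ((a.V ⊗ₖ r.V) * DA * (a.V ⊗ₖ r.V)ᴴ)) * (a.V ⊗ₖ r.V) := by
          rw [hW]; simp only [Matrix.mul_assoc]
      _ = (b.V ⊗ₖ s.V)ᴴ * ((b.V ⊗ₖ s.V) * DB * (b.V ⊗ₖ s.V)ᴴ * U) * (a.V ⊗ₖ r.V) := h1
      _ = ((b.V ⊗ₖ s.V)ᴴ * (b.V ⊗ₖ s.V)) * DB * W := by
          rw [hW]; simp only [Matrix.mul_assoc]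
      _ = DB * W := by rw [b.kronecker_conjTranspose_mul s, Matrix.one_mul]
  have hzero : ∀ z w i j, W (w, j) (z, i) ≠ 0 →
      a.gibbsWeight β z * r.gibbsWeight β i = b.gibbsWeight β w * s.gibbsWeight β j := by
    intro z w i j hne
    have h1 := congrFun (congrFun hWint (w, j)) (z, i)
    rw [Matrix.mul_diagonal, Matrix.diagonal_mul, mul_comm] at h1
    exact_mod_cast mul_right_cancel₀ hne h1
  rw [energyCoeff, hEU, hUW, r.gibbs_eq_lift, rep_traceSnd_interaction,
    traceSnd_single_kronecker_diagonal]
  refine Finset.sum_eq_zero fun j _ => Finset.sum_eq_zero fun i _ => ?_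
  by_contra hne
  have h1 := hzero x y i j (fun h0 => hne (by rw [h0, zero_mul, zero_mul]))
  have h2 := hzero x' y' i j (fun h0 => hne (by rw [h0, star_zero, mul_zero]))
  exact h (hab x x' y y'
    (a.energy_sub_eq_of_gibbsWeight b hβ (r.gibbsWeight_pos β i).ne' h1 h2))

lemma traceSnd_kronecker {κ δ : Type*} [Fintype δ] (M : Matrix κ κ ℂ) (N : Matrix δ δ ℂ) :
    traceSnd (M ⊗ₖ N) = N.trace • M := by
  ext y y'
  simp [traceSnd, Matrix.trace, Finset.mul_sum, mul_comm]

lemma EnergyBasis.trace_gibbs [Nonempty ι] (a : EnergyBasis A) (β : ℝ) : (gibbs β A).trace = 1 := by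
  rw [a.gibbs_eq_lift, a.trace_lift, Matrix.trace_diagonal, ← Complex.ofReal_sum,
    a.sum_gibbsWeight, Complex.ofReal_one]

lemma map_gibbs_of_TO {β : ℝ} {E : Matrix ι ι ℂ →ₗ[ℂ] Matrix κ κ ℂ} (hE : E ∈ TO β A B) :
    E (gibbs β A) = gibbs β B := by
  obtain ⟨d, d', -, hd', R, S, U, -, -, hgibbs, hEU⟩ := hE
  have : Nonempty (Fin d') := ⟨⟨0, hd'⟩⟩
  obtain ⟨s⟩ := nonempty_energyBasis S
  rw [hEU, hgibbs, traceSnd_kronecker, s.trace_gibbs, one_smul]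

lemma energyCoeff_eq_zero_of_CTO [Nonempty ι] [Nonempty κ] {β : ℝ} (hβ : β ≠ 0)
    (hab : RelativelyNondegenerate a b) {E : Matrix ι ι ℂ →ₗ[ℂ] Matrix κ κ ℂ} (hE : E ∈ CTO β A B)
    (x x' : ι) (y y' : κ) (h : ¬ (x = x' ∧ y = y')) : energyCoeff a b E x x' y y' = 0 := by
  obtain ⟨-, Es, hEs, hlim⟩ := hE
  have hcont : Continuous fun M : Matrix κ κ ℂ => b.rep M y y' := by
    unfold EnergyBasis.rep
    fun_prop
  have h1 := (hcont.tendsto _).comp (hlim (a.lift (Matrix.single x x' 1)))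
  refine tendsto_nhds_unique h1 (tendsto_const_nhds.congr fun k => ?_)
  exact (energyCoeff_eq_zero_of_TO a b hβ hab (hEs k) x x' y y' h).symm

lemma map_gibbs_of_CTO {β : ℝ} {E : Matrix ι ι ℂ →ₗ[ℂ] Matrix κ κ ℂ} (hE : E ∈ CTO β A B) :
    E (gibbs β A) = gibbs β B := by
  obtain ⟨-, Es, hEs, hlim⟩ := hE
  refine tendsto_nhds_unique (hlim _) (tendsto_const_nhds.congr fun k => ?_)
  exact (map_gibbs_of_TO (hEs k)).symm

/-! ### Thermal operations from weight preserving bijections -/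

/-- The system with diagonal Hamiltonian whose Gibbs state has the prescribed weights. -/
noncomputable def bathSystem {δ : Type*} [DecidableEq δ] (β : ℝ) (g : δ → ℝ) : PhysSystem δ where
  H := diagonal fun i => ((-(Real.log (g i) / β) : ℝ) : ℂ)
  hermitian := by
    rw [Matrix.isHermitian_diagonal_iff]
    exact fun i => Complex.conj_ofReal _

/-- The computational basis as energy eigenbasis of `bathSystem`. -/
noncomputable def bathBasis {δ : Type*} [Fintype δ] [DecidableEq δ] (β : ℝ) (g : δ → ℝ) :
    EnergyBasis (bathSystem β g) where
  energy i := -(Real.log (g i) / β)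
  V := 1
  unitary := one_mem _
  spectral := by simp [bathSystem]

lemma bathBasis_gibbsWeight {δ : Type*} [Fintype δ] [DecidableEq δ] {β : ℝ} (hβ : β ≠ 0)
    {g : δ → ℝ} (hg : ∀ i, 0 < g i) (hsum : ∑ i, g i = 1) :
    (bathBasis β g).gibbsWeight β = g := by
  have h : ∀ i, Real.exp (-β * (bathBasis β g).energy i) = g i := by
    intro i
    have : -β * (bathBasis β g).energy i = Real.log (g i) := by
      simp only [bathBasis]
      field_simp
    rw [this, Real.exp_log (hg i)]
  ext i
  simp only [EnergyBasis.gibbsWeight, h, hsum, div_one]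

/-- A weight preserving relabelling of the joint energy levels of system and bath implements a
thermal operation, whose transition probabilities count the bath weight of the relabelled
levels. -/
lemma exists_TO_of_equiv_fin [Nonempty ι] {β : ℝ} (hβ : β ≠ 0) {d d' : ℕ}
    (hd : 0 < d) (hd' : 0 < d') {g : Fin d → ℝ} {g' : Fin d' → ℝ} (hg : ∀ i, 0 < g i)
    (hg' : ∀ j, 0 < g' j) (hsum : ∑ i, g i = 1) (hsum' : ∑ j, g' j = 1)
    (π : ι × Fin d ≃ κ × Fin d')
    (hπ : ∀ i, b.gibbsWeight β (π i).1 * g' (π i).2 = a.gibbsWeight β i.1 * g i.2) :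
    ∃ E ∈ TO β A B, ∀ x y, energyCoeff a b E x x y y =
      ((∑ i, if (π (x, i)).1 = y then g i else 0 : ℝ) : ℂ) := by
  set r := bathBasis β g
  set s := bathBasis β g'
  set W : Matrix (κ × Fin d') (ι × Fin d) ℂ := (1 : Matrix _ _ ℂ).submatrix π.symm id with hW
  have hWW : Wᴴ * W = 1 := by
    rw [hW, Matrix.conjTranspose_submatrix, Matrix.conjTranspose_one,
      Matrix.submatrix_mul_equiv _ _ _ π.symm, Matrix.mul_one, Matrix.submatrix_id_id]
  have hWW' : W * Wᴴ = 1 := by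
    rw [hW, Matrix.conjTranspose_submatrix, Matrix.conjTranspose_one,
      ← Equiv.coe_refl, Matrix.submatrix_mul_equiv, Matrix.mul_one, Matrix.submatrix_one_equiv]
  have hWD : W * (diagonal (fun x => (a.gibbsWeight β x : ℂ)) ⊗ₖ
      diagonal (fun i => (g i : ℂ))) * Wᴴ = diagonal (fun y => (b.gibbsWeight β y : ℂ)) ⊗ₖ
      diagonal (fun j => (g' j : ℂ)) := by
    rw [Matrix.diagonal_kronecker_diagonal, Matrix.diagonal_kronecker_diagonal]
    have h1 : W * diagonal (fun i : ι × Fin d => (a.gibbsWeight β i.1 * g i.2 : ℂ)) =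
        diagonal (fun j : κ × Fin d' => (b.gibbsWeight β j.1 * g' j.2 : ℂ)) * W := by
      ext j i
      rw [Matrix.mul_diagonal, Matrix.diagonal_mul, hW, Matrix.submatrix_apply, id,
        Matrix.one_apply]
      split_ifs with hji
      · rw [← hji, one_mul, mul_one]
        have := hπ (π.symm j)
        rw [Equiv.apply_symm_apply] at this
        exact_mod_cast this.symm
      · simp
    rw [h1, Matrix.mul_assoc, hWW', Matrix.mul_one]
  set U := (b.V ⊗ₖ s.V) * W * (a.V ⊗ₖ r.V)ᴴ with hU
  have hUH : Uᴴ = (a.V ⊗ₖ r.V) * Wᴴ * (b.V ⊗ₖ s.V)ᴴ := by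
    rw [hU]
    simp only [Matrix.conjTranspose_mul, Matrix.conjTranspose_conjTranspose, Matrix.mul_assoc]
  have hUU : Uᴴ * U = 1 := by
    calc Uᴴ * U = (a.V ⊗ₖ r.V) * (Wᴴ * ((b.V ⊗ₖ s.V)ᴴ * (b.V ⊗ₖ s.V)) * W) * (a.V ⊗ₖ r.V)ᴴ := by
          rw [hUH, hU]; simp only [Matrix.mul_assoc]
      _ = 1 := by
          rw [b.kronecker_conjTranspose_mul s, Matrix.mul_one, hWW, Matrix.mul_one,
            a.kronecker_mul_conjTranspose r]
  have hUU' : U * Uᴴ = 1 := by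
    calc U * Uᴴ = (b.V ⊗ₖ s.V) * (W * ((a.V ⊗ₖ r.V)ᴴ * (a.V ⊗ₖ r.V)) * Wᴴ) * (b.V ⊗ₖ s.V)ᴴ := by
          rw [hUH, hU]; simp only [Matrix.mul_assoc]
      _ = 1 := by
          rw [a.kronecker_conjTranspose_mul r, Matrix.mul_one, hWW', Matrix.mul_one,
            b.kronecker_mul_conjTranspose s]
  have hgr : gibbs β (bathSystem β g) = r.lift (diagonal fun i => (g i : ℂ)) := by
    rw [r.gibbs_eq_lift, bathBasis_gibbsWeight hβ hg hsum]
  have hgs : gibbs β (bathSystem β g') = s.lift (diagonal fun i => (g' i : ℂ)) := by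
    rw [s.gibbs_eq_lift, bathBasis_gibbsWeight hβ hg' hsum']
  let E : Matrix ι ι ℂ →ₗ[ℂ] Matrix κ κ ℂ :=
    { toFun := fun X => traceSnd (U * (X ⊗ₖ gibbs β (bathSystem β g)) * Uᴴ)
      map_add' := fun X Y => by
        rw [Matrix.add_kronecker, Matrix.mul_add, Matrix.add_mul]
        ext y y'
        simp [traceSnd, Finset.sum_add_distrib]
      map_smul' := fun c X => by
        rw [Matrix.smul_kronecker, Matrix.mul_smul, Matrix.smul_mul]
        ext y y'
        simp [traceSnd, Finset.mul_sum] }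
  refine ⟨E, ⟨d, d', hd, hd', bathSystem β g, bathSystem β g', U, hUU, hUU', ?_, fun X => rfl⟩, ?_⟩
  · rw [hgr, hgs, a.gibbs_eq_lift, b.gibbs_eq_lift, a.lift_kronecker_lift r,
      b.lift_kronecker_lift s, ← hWD, hUH, hU]
    set DA := diagonal (fun x => (a.gibbsWeight β x : ℂ)) ⊗ₖ diagonal (fun i => (g i : ℂ))
    calc _ = (b.V ⊗ₖ s.V) * (W * (((a.V ⊗ₖ r.V)ᴴ * (a.V ⊗ₖ r.V)) * DA *
          ((a.V ⊗ₖ r.V)ᴴ * (a.V ⊗ₖ r.V))) * Wᴴ) * (b.V ⊗ₖ s.V)ᴴ := by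
          simp only [Matrix.mul_assoc]
      _ = _ := by rw [a.kronecker_conjTranspose_mul r, Matrix.one_mul, Matrix.mul_one]
  · intro x y
    change b.rep (traceSnd (U * (a.lift (Matrix.single x x 1) ⊗ₖ gibbs β (bathSystem β g)) * Uᴴ))
      y y = _
    rw [hgr, hU, rep_traceSnd_interaction, traceSnd_single_kronecker_diagonal, Finset.sum_comm,
      Complex.ofReal_sum]
    refine Finset.sum_congr rfl fun i _ => ?_
    have h1 : ∀ j, W (y, j) (x, i) = if π (x, i) = (y, j) then 1 else 0 := by
      intro j
      rw [hW, Matrix.submatrix_apply, id, Matrix.one_apply]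
      simp only [Equiv.symm_apply_eq, eq_comm (b := (y, j))]
    simp only [h1]
    split_ifs with hy
    · rw [Finset.sum_eq_single (π (x, i)).2]
      · have hy' : π (x, i) = (y, (π (x, i)).2) := Prod.ext hy rfl
        rw [if_pos hy']; simp
      · intro j _ hj
        rw [if_neg (fun h => hj (by rw [h]))]; simp
      · simp
    · rw [Complex.ofReal_zero]
      refine Finset.sum_eq_zero fun j _ => ?_
      rw [if_neg (fun h => hy (by rw [h]))]; simp

/-- The baths may be indexed by arbitrary finite types. -/
lemma exists_TO_of_equiv [Nonempty ι] {β : ℝ} (hβ : β ≠ 0) {δ δ' : Type*} [Fintype δ] [Fintype δ']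
    [Nonempty δ] [Nonempty δ'] {g : δ → ℝ} {g' : δ' → ℝ} (hg : ∀ i, 0 < g i)
    (hg' : ∀ j, 0 < g' j) (hsum : ∑ i, g i = 1) (hsum' : ∑ j, g' j = 1)
    (π : ι × δ ≃ κ × δ')
    (hπ : ∀ i, b.gibbsWeight β (π i).1 * g' (π i).2 = a.gibbsWeight β i.1 * g i.2) :
    ∃ E ∈ TO β A B, ∀ x y, energyCoeff a b E x x y y =
      ((∑ i, if (π (x, i)).1 = y then g i else 0 : ℝ) : ℂ) := by
  let f := Fintype.equivFin δ
  let f' := Fintype.equivFin δ'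
  obtain ⟨E, hE, hcoeff⟩ := exists_TO_of_equiv_fin a b hβ (d := Fintype.card δ)
    (d' := Fintype.card δ') Fintype.card_pos Fintype.card_pos (g := g ∘ f.symm)
    (g' := g' ∘ f'.symm) (fun i => hg _) (fun j => hg' _)
    (by rw [← hsum]; exact f.symm.sum_comp g) (by rw [← hsum']; exact f'.symm.sum_comp g')
    (((Equiv.refl ι).prodCongr f.symm).trans (π.trans ((Equiv.refl κ).prodCongr f')))
    (fun i => by simpa [Prod.map] using hπ (i.1, f.symm i.2))
  refine ⟨E, hE, fun x y => ?_⟩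
  rw [hcoeff]
  congr 1
  exact f.symm.sum_comp fun i => if (π (x, i)).1 = y then g i else 0

end ThermalOperations

/-! ### Permutations with prescribed numbers of transitions -/

/-- Prescribed numbers of transitions between two colourings of a finite set are realized by a
permutation as soon as the colour classes are large enough. -/
lemma exists_perm_card_transitions {Ω ι κ : Type*} [Fintype Ω] [Fintype ι] [DecidableEq ι]
    [Fintype κ] [DecidableEq κ] (f : Ω → ι) (g : Ω → κ) (M : κ → ι → ℕ)
    (hf : ∀ x, ∑ y, M y x ≤ Fintype.card {ω // f ω = x})
    (hg : ∀ y, ∑ x, M y x ≤ Fintype.card {ω // g ω = y}) :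
    ∃ π : Equiv.Perm Ω, ∀ x y, M y x ≤ Fintype.card {ω // f ω = x ∧ g (π ω) = y} := by
  have hi : ∀ x, Nonempty ((Σ y, Fin (M y x)) ↪ {ω // f ω = x}) := fun x =>
    Function.Embedding.nonempty_of_card_le (by simpa using hf x)
  have hj : ∀ y, Nonempty ((Σ x, Fin (M y x)) ↪ {ω // g ω = y}) := fun y =>
    Function.Embedding.nonempty_of_card_le (by simpa using hg y)
  let i := fun x => (hi x).some
  let j := fun y => (hj y).some
  -- The two placements of the transitions, by source colour and by target colour.
  let F : (Σ x, Σ y, Fin (M y x)) → Ω := fun a => (i a.1 a.2).1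
  let G : (Σ x, Σ y, Fin (M y x)) → Ω := fun a => (j a.2.1 ⟨a.1, a.2.2⟩).1
  have hF : Function.Injective F := by
    rintro ⟨x, a⟩ ⟨x', a'⟩ h
    obtain rfl : x = x' := by
      rw [← (i x a).2, ← (i x' a').2]
      exact congrArg f h
    obtain rfl : a = a' := (i x).injective (Subtype.ext h)
    rfl
  have hG : Function.Injective G := by
    rintro ⟨x, y, a⟩ ⟨x', y', a'⟩ h
    obtain rfl : y = y' := by
      rw [← (j y ⟨x, a⟩).2, ← (j y' ⟨x', a'⟩).2]
      exact congrArg g h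
    have h2 : (⟨x, a⟩ : Σ x, Fin (M y x)) = ⟨x', a'⟩ := (j y).injective (Subtype.ext h)
    cases h2
    rfl
  obtain ⟨π, hπ⟩ := Equiv.Perm.exists_extending_pair F G hF hG
  refine ⟨π, fun x y => ?_⟩
  have hinj : Function.Injective fun a : Fin (M y x) =>
      (⟨F ⟨x, y, a⟩, (i x ⟨y, a⟩).2, by rw [hπ]; exact (j y ⟨x, a⟩).2⟩ :
        {ω // f ω = x ∧ g (π ω) = y}) := by
    intro a a' h
    have h2 : F ⟨x, y, a⟩ = F ⟨x, y, a'⟩ := Subtype.mk.inj h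
    simpa using hF h2
  simpa using Fintype.card_le_of_injective _ hinj

/-- The version of `exists_perm_card_transitions` for permutations that preserve a label. -/
lemma exists_perm_card_transitions_fiberwise {Ω ι κ L : Type*} [Fintype Ω] [Fintype ι]
    [DecidableEq ι] [Fintype κ] [DecidableEq κ] [DecidableEq L] (l : Ω → L) (f : Ω → ι) (g : Ω → κ)
    (M : L → κ → ι → ℕ)
    (hf : ∀ k x, ∑ y, M k y x ≤ Fintype.card {ω // l ω = k ∧ f ω = x})
    (hg : ∀ k y, ∑ x, M k y x ≤ Fintype.card {ω // l ω = k ∧ g ω = y}) :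
    ∃ π : Equiv.Perm Ω, (∀ ω, l (π ω) = l ω) ∧
      ∀ k x y, M k y x ≤ Fintype.card {ω // l ω = k ∧ f ω = x ∧ g (π ω) = y} := by
  have h : ∀ k, ∃ π : Equiv.Perm {ω // l ω = k}, ∀ x y,
      M k y x ≤ Fintype.card {ω : {ω // l ω = k} // f ω.1 = x ∧ g (π ω).1 = y} := by
    intro k
    refine exists_perm_card_transitions (fun ω : {ω // l ω = k} => f ω.1) (fun ω => g ω.1) (M k)
      (fun x => (hf k x).trans_eq ?_) (fun y => (hg k y).trans_eq ?_)
    · exact (Fintype.card_congr (Equiv.subtypeSubtypeEquivSubtypeInter _ fun ω => f ω = x)).symm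
    · exact (Fintype.card_congr (Equiv.subtypeSubtypeEquivSubtypeInter _ fun ω => g ω = y)).symm
  choose π hπ using h
  refine ⟨Equiv.ofFiberEquiv π, fun ω => Equiv.ofFiberEquiv_map π ω, fun k x y => ?_⟩
  refine (hπ k x y).trans ?_
  have hval : ∀ ω : {ω // l ω = k}, Equiv.ofFiberEquiv π ω.1 = (π k ω).1 := by
    rintro ⟨ω, rfl⟩
    rfl
  refine Fintype.card_le_of_injective
    (fun ω => ⟨ω.1.1, ω.1.2, ω.2.1, by rw [hval]; exact ω.2.2⟩) ?_
  intro ω ω' hω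
  exact Subtype.ext (Subtype.ext (Subtype.mk.inj hω))

/-! ### A bath with nearly equal weight on all levels -/

section Bath

variable {α : Type*} [Fintype α]

/-- The Boltzmann weight `∏ z, g z ^ k z` of the energy level with label `k`. -/
def levelWeight (g : α → ℝ) (k : α → ℕ) : ℝ := ∏ z, g z ^ k z

lemma levelWeight_pos {g : α → ℝ} (hg : ∀ z, 0 < g z) (k : α → ℕ) : 0 < levelWeight g k :=
  Finset.prod_pos fun z _ => pow_pos (hg z) _

lemma levelWeight_le_one {g : α → ℝ} (hg : ∀ z, 0 < g z) (hg1 : ∀ z, g z ≤ 1) (k : α → ℕ) :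
    levelWeight g k ≤ 1 :=
  Finset.prod_le_one (fun z _ => (pow_pos (hg z) _).le) fun z _ => pow_le_one₀ (hg z).le (hg1 z)

lemma levelWeight_add (g : α → ℝ) (k l : α → ℕ) :
    levelWeight g (k + l) = levelWeight g k * levelWeight g l := by
  simp [levelWeight, pow_add, Finset.prod_mul_distrib]

lemma levelWeight_single [DecidableEq α] (g : α → ℝ) (z : α) :
    levelWeight g (Pi.single z 1) = g z := by
  rw [levelWeight, Finset.prod_eq_single z]
  · simp
  · intro w _ hw
    simp [hw]
  · simp

/-- The degeneracy of the level `k`, chosen such that every level carries total weight about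
`N`. -/
noncomputable def degeneracy (g : α → ℝ) (N : ℕ) (k : α → ℕ) : ℕ := ⌈N / levelWeight g k⌉₊

/-- The energy eigenstates of a bath whose levels are labelled by the box `{0, …, N - 1} ^ α`. -/
abbrev BathState [DecidableEq α] (g : α → ℝ) (N : ℕ) : Type _ :=
  Σ k : Fintype.piFinset (fun _ : α => Finset.range N), Fin (degeneracy g N k.1)

lemma sum_levelWeight_le [DecidableEq α] {g : α → ℝ} (hg : ∀ z, 0 < g z) (hg1 : ∀ z, g z ≤ 1)
    (N : ℕ) :
    ∑ s : BathState g N, levelWeight g s.1.1 ≤ (N : ℝ) ^ Fintype.card α * (N + 1) := by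
  rw [Fintype.sum_sigma]
  have h : ∀ k : Fintype.piFinset (fun _ : α => Finset.range N),
      ∑ _i : Fin (degeneracy g N k.1), levelWeight g k.1 ≤ (N : ℝ) + 1 := by
    intro k
    have hv := levelWeight_pos hg k.1
    rw [Finset.sum_const, Finset.card_univ, Fintype.card_fin, nsmul_eq_mul]
    have h1 : (degeneracy g N k.1 : ℝ) ≤ N / levelWeight g k.1 + 1 :=
      (Nat.ceil_lt_add_one (by positivity)).le
    calc (degeneracy g N k.1 : ℝ) * levelWeight g k.1
        ≤ (N / levelWeight g k.1 + 1) * levelWeight g k.1 :=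
          mul_le_mul_of_nonneg_right h1 hv.le
      _ = N + levelWeight g k.1 := by field_simp
      _ ≤ N + 1 := by linarith [levelWeight_le_one hg hg1 k.1]
  refine (Finset.sum_le_sum fun k _ => h k).trans_eq ?_
  rw [Finset.sum_const, Finset.card_univ, nsmul_eq_mul, Fintype.card_coe,
    Fintype.card_piFinset, Finset.prod_const, Finset.card_range, Finset.card_univ]
  push_cast
  rfl

end Bath

section Transitions

universe u v

variable {ι : Type u} {κ : Type v} [Fintype ι] [DecidableEq ι] [Fintype κ] [DecidableEq κ]

/-- The joint label of a level of system `ι`, a level of system `κ` and a bath level. -/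
def jointLabel {g : ι ⊕ κ → ℝ} {N : ℕ} (ω : ι × κ × BathState g N) : ι ⊕ κ → ℕ :=
  ω.2.2.1.1 + Pi.single (Sum.inl ω.1) 1 + Pi.single (Sum.inr ω.2.1) 1

lemma levelWeight_jointLabel {g : ι ⊕ κ → ℝ} {N : ℕ} (ω : ι × κ × BathState g N) :
    levelWeight g (jointLabel ω) =
      levelWeight g ω.2.2.1.1 * g (Sum.inl ω.1) * g (Sum.inr ω.2.1) := by
  rw [jointLabel, levelWeight_add, levelWeight_add, levelWeight_single, levelWeight_single]

/-- The labels `k` with `1 ≤ k z < N` for all `z`. For these all levels that a transition has to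
connect lie in the bath. -/
def interiorLabels (ι κ : Type*) [Fintype ι] [DecidableEq ι] [Fintype κ] [DecidableEq κ] (N : ℕ) :
    Finset (ι ⊕ κ → ℕ) :=
  Fintype.piFinset fun _ => Finset.Ico 1 N

/-- The label of the bath levels that, together with the levels `x` and `y`, form joint levels of
label `k`. The subtraction is truncated, but not for interior labels. -/
def bathLabel (k : ι ⊕ κ → ℕ) (x : ι) (y : κ) : ι ⊕ κ → ℕ :=
  k - Pi.single (Sum.inl x) 1 - Pi.single (Sum.inr y) 1

lemma bathLabel_add_single {N : ℕ} {k : ι ⊕ κ → ℕ} (hk : k ∈ interiorLabels ι κ N) (x : ι)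
    (y : κ) : bathLabel k x y + Pi.single (Sum.inl x) 1 + Pi.single (Sum.inr y) 1 = k := by
  ext z
  have hz := Finset.mem_Ico.1 (Fintype.mem_piFinset.1 hk z)
  rcases z with z | z
  · simp only [bathLabel, Pi.add_apply, Pi.sub_apply, Pi.single_apply, Sum.inl.injEq, reduceCtorEq, if_false]
    split_ifs <;> omega
  · simp only [bathLabel, Pi.add_apply, Pi.sub_apply, Pi.single_apply, Sum.inr.injEq, reduceCtorEq, if_false]
    split_ifs <;> omega

lemma bathLabel_mem {N : ℕ} {k : ι ⊕ κ → ℕ} (hk : k ∈ interiorLabels ι κ N) (x : ι) (y : κ) :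
    bathLabel k x y ∈ Fintype.piFinset (fun _ : ι ⊕ κ => Finset.range N) := by
  rw [Fintype.mem_piFinset]
  intro z
  have hz := Finset.mem_Ico.1 (Fintype.mem_piFinset.1 hk z)
  rw [Finset.mem_range]
  simp only [bathLabel, Pi.sub_apply]
  omega

/-- The joint levels with label `k` and given levels of the two systems. -/
def jointState {g : ι ⊕ κ → ℝ} {N : ℕ} {k : ι ⊕ κ → ℕ} (hk : k ∈ interiorLabels ι κ N) (x : ι)
    (y : κ) (a : Fin (degeneracy g N (bathLabel k x y))) :
    ι × κ × BathState g N :=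
  (x, y, ⟨⟨_, bathLabel_mem hk x y⟩, a⟩)

lemma jointLabel_jointState {g : ι ⊕ κ → ℝ} {N : ℕ} {k : ι ⊕ κ → ℕ}
    (hk : k ∈ interiorLabels ι κ N) (x : ι) (y : κ)
    (a : Fin (degeneracy g N (bathLabel k x y))) :
    jointLabel (jointState hk x y a) = k :=
  bathLabel_add_single hk x y

lemma jointState_injective {g : ι ⊕ κ → ℝ} {N : ℕ} {k : ι ⊕ κ → ℕ}
    (hk : k ∈ interiorLabels ι κ N) (x : ι) (y : κ) :
    Function.Injective (jointState (g := g) hk x y) := by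
  intro a a' h
  have h1 : (⟨⟨_, bathLabel_mem hk x y⟩, a⟩ : BathState g N) = ⟨⟨_, bathLabel_mem hk x y⟩, a'⟩ :=
    congrArg (fun ω => ω.2.2) h
  exact eq_of_heq (Sigma.mk.inj_iff.1 h1).2

lemma le_degeneracy_bathLabel {g : ι ⊕ κ → ℝ} (hg : ∀ z, 0 < g z) {N : ℕ} {k : ι ⊕ κ → ℕ}
    (hk : k ∈ interiorLabels ι κ N) (x : ι) (y : κ) :
    N * (g (Sum.inl x) * g (Sum.inr y)) / levelWeight g k ≤
      degeneracy g N (bathLabel k x y) := by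
  refine le_trans (le_of_eq ?_) (Nat.le_ceil _)
  conv_lhs => rw [← bathLabel_add_single hk x y, levelWeight_add, levelWeight_add,
    levelWeight_single, levelWeight_single]
  have := (hg (Sum.inl x)).ne'
  have := (hg (Sum.inr y)).ne'
  have := (levelWeight_pos hg (bathLabel k x y)).ne'
  field_simp

/-- There are enough joint levels with label `k` and given level of the first system. -/
lemma le_card_jointLabel_fst {g : ι ⊕ κ → ℝ} (hg : ∀ z, 0 < g z)
    (hsum : ∑ y, g (Sum.inr y) = 1) {N : ℕ} {k : ι ⊕ κ → ℕ}
    (hk : k ∈ interiorLabels ι κ N) (x : ι) :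
    N * g (Sum.inl x) / levelWeight g k ≤
      Fintype.card {ω : ι × κ × BathState g N // jointLabel ω = k ∧ ω.1 = x} := by
  have hinj : Function.Injective
      (fun a : Σ y : κ, Fin (degeneracy g N (bathLabel k x y))
        => (⟨jointState (g := g) hk x a.1 a.2, jointLabel_jointState (g := g) hk x a.1 a.2, rfl⟩ :
          {ω : ι × κ × BathState g N // jointLabel ω = k ∧ ω.1 = x})) := by
    rintro ⟨y, a⟩ ⟨y', a'⟩ h
    have h1 : jointState hk x y a = jointState hk x y' a' := Subtype.mk.inj h
    obtain rfl : y = y' := congrArg (fun ω => ω.2.1) h1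
    rw [jointState_injective hk x y h1]
  have hcard := Fintype.card_le_of_injective _ hinj
  rw [Fintype.card_sigma] at hcard
  simp only [Fintype.card_fin] at hcard
  calc N * g (Sum.inl x) / levelWeight g k
      = ∑ y, N * (g (Sum.inl x) * g (Sum.inr y)) / levelWeight g k := by
        rw [← Finset.sum_div, ← Finset.mul_sum, ← Finset.mul_sum, hsum, mul_one]
    _ ≤ ∑ y, (degeneracy g N (bathLabel k x y) : ℝ) :=
        Finset.sum_le_sum fun y _ => le_degeneracy_bathLabel hg hk x y
    _ ≤ _ := by exact_mod_cast hcard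

/-- There are enough joint levels with label `k` and given level of the second system. -/
lemma le_card_jointLabel_snd {g : ι ⊕ κ → ℝ} (hg : ∀ z, 0 < g z)
    (hsum : ∑ x, g (Sum.inl x) = 1) {N : ℕ} {k : ι ⊕ κ → ℕ}
    (hk : k ∈ interiorLabels ι κ N) (y : κ) :
    N * g (Sum.inr y) / levelWeight g k ≤
      Fintype.card {ω : ι × κ × BathState g N // jointLabel ω = k ∧ ω.2.1 = y} := by
  have hinj : Function.Injective
      (fun a : Σ x : ι, Fin (degeneracy g N (bathLabel k x y))
        => (⟨jointState (g := g) hk a.1 y a.2, jointLabel_jointState (g := g) hk a.1 y a.2, rfl⟩ :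
          {ω : ι × κ × BathState g N // jointLabel ω = k ∧ ω.2.1 = y})) := by
    rintro ⟨x, a⟩ ⟨x', a'⟩ h
    have h1 : jointState hk x y a = jointState hk x' y a' := Subtype.mk.inj h
    obtain rfl : x = x' := congrArg (fun ω => ω.1) h1
    rw [jointState_injective hk x y h1]
  have hcard := Fintype.card_le_of_injective _ hinj
  rw [Fintype.card_sigma] at hcard
  simp only [Fintype.card_fin] at hcard
  calc N * g (Sum.inr y) / levelWeight g k
      = ∑ x, N * (g (Sum.inl x) * g (Sum.inr y)) / levelWeight g k := by
        rw [← Finset.sum_div, ← Finset.mul_sum, ← Finset.sum_mul, hsum, one_mul]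
    _ ≤ ∑ x, (degeneracy g N (bathLabel k x y) : ℝ) :=
        Finset.sum_le_sum fun x _ => le_degeneracy_bathLabel hg hk x y
    _ ≤ _ := by exact_mod_cast hcard

/-- The number of transitions from level `x` to level `y` within the joint levels of label `k`
that approximates the transition matrix `T`. -/
noncomputable def transitionNumber (g : ι ⊕ κ → ℝ) (T : Matrix κ ι ℝ) (N : ℕ) (k : ι ⊕ κ → ℕ)
    (y : κ) (x : ι) : ℕ :=
  if k ∈ interiorLabels ι κ N then ⌊N * (T y x * g (Sum.inl x)) / levelWeight g k⌋₊ else 0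

/-- A label preserving permutation of the joint levels that realizes all the transition numbers.
The column sums of `T` control the sources, and the equation `T *ᵥ p = q` the targets. -/
lemma exists_perm_transitionNumber {g : ι ⊕ κ → ℝ} (hg : ∀ z, 0 < g z)
    (hsum : ∑ x, g (Sum.inl x) = 1) (hsum' : ∑ y, g (Sum.inr y) = 1) {T : Matrix κ ι ℝ}
    (h0 : ∀ y x, 0 ≤ T y x) (h1 : ∀ x, ∑ y, T y x = 1)
    (hT : ∀ y, ∑ x, T y x * g (Sum.inl x) = g (Sum.inr y)) (N : ℕ) :
    ∃ π : Equiv.Perm (ι × κ × BathState g N), (∀ ω, jointLabel (π ω) = jointLabel ω) ∧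
      ∀ k x y, transitionNumber g T N k y x ≤
        Fintype.card {ω // jointLabel ω = k ∧ ω.1 = x ∧ (π ω).2.1 = y} := by
  have hfloor : ∀ k ∈ interiorLabels ι κ N, ∀ x y,
      (transitionNumber g T N k y x : ℝ) ≤ N * (T y x * g (Sum.inl x)) / levelWeight g k := by
    intro k hk x y
    rw [transitionNumber, if_pos hk]
    have := levelWeight_pos hg k
    have := hg (Sum.inl x)
    have := h0 y x
    exact Nat.floor_le (by positivity)
  refine exists_perm_card_transitions_fiberwise jointLabel Prod.fst (fun ω => ω.2.1)
    (transitionNumber g T N) (fun k x => ?_) (fun k y => ?_)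
  · by_cases hk : k ∈ interiorLabels ι κ N
    · have h2 := (Finset.sum_le_sum fun y _ => hfloor k hk x y).trans_eq
        (show ∑ y, N * (T y x * g (Sum.inl x)) / levelWeight g k = _ by
          rw [← Finset.sum_div, ← Finset.mul_sum, ← Finset.sum_mul, h1, one_mul])
      exact_mod_cast h2.trans (le_card_jointLabel_fst hg hsum' hk x)
    · simp [transitionNumber, hk]
  · by_cases hk : k ∈ interiorLabels ι κ N
    · have h2 := (Finset.sum_le_sum fun x _ => hfloor k hk x y).trans_eq
        (show ∑ x, N * (T y x * g (Sum.inl x)) / levelWeight g k = _ by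
          rw [← Finset.sum_div, ← Finset.mul_sum, hT])
      exact_mod_cast h2.trans (le_card_jointLabel_snd hg hsum hk y)
    · simp [transitionNumber, hk]

lemma levelWeight_le_inl {g : ι ⊕ κ → ℝ} (hg : ∀ z, 0 < g z) (hg1 : ∀ z, g z ≤ 1) {N : ℕ}
    {k : ι ⊕ κ → ℕ} (hk : k ∈ interiorLabels ι κ N) (x : ι) :
    levelWeight g k ≤ g (Sum.inl x) := by
  have h1 := (Finset.mem_Ico.1 (Fintype.mem_piFinset.1 hk (Sum.inl x))).1
  rw [levelWeight, ← Finset.mul_prod_erase _ _ (Finset.mem_univ (Sum.inl x))]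
  refine (mul_le_of_le_one_right (pow_pos (hg _) _).le (Finset.prod_le_one
    (fun z _ => (pow_pos (hg z) _).le) fun z _ => pow_le_one₀ (hg z).le (hg1 z))).trans ?_
  exact pow_le_of_le_one (hg _).le (hg1 _) (by omega)

lemma le_transitionNumber_mul {g : ι ⊕ κ → ℝ} (hg : ∀ z, 0 < g z) (hg1 : ∀ z, g z ≤ 1)
    (T : Matrix κ ι ℝ) {N : ℕ} {k : ι ⊕ κ → ℕ} (hk : k ∈ interiorLabels ι κ N) (x : ι) (y : κ) :
    g (Sum.inl x) * (N * T y x - 1) ≤ transitionNumber g T N k y x * levelWeight g k := by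
  have hv := levelWeight_pos hg k
  rw [transitionNumber, if_pos hk]
  have h1 := (Nat.sub_one_lt_floor (N * (T y x * g (Sum.inl x)) / levelWeight g k)).le
  have h2 := mul_le_mul_of_nonneg_right h1 hv.le
  rw [sub_mul, div_mul_cancel₀ _ hv.ne'] at h2
  linarith [levelWeight_le_inl hg hg1 hk x]

/-- A finite bath with a weight preserving permutation of the joint levels, whose transition
probabilities are bounded below by those of `T` up to the relative volume `(n / (n + 1)) ^ D` of
the interior of a box and a rounding error. -/
lemma exists_bath_perm [Nonempty ι] [Nonempty κ] {p : ι → ℝ} {q : κ → ℝ} (hp : ∀ x, 0 < p x)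
    (hq : ∀ y, 0 < q y) (hpsum : ∑ x, p x = 1) (hqsum : ∑ y, q y = 1) {T : Matrix κ ι ℝ}
    (h0 : ∀ y x, 0 ≤ T y x) (h1 : ∀ x, ∑ y, T y x = 1) (hT : T *ᵥ p = q) (n : ℕ) :
    ∃ (P : Type (max u v)) (_ : Fintype P) (_ : Nonempty P) (w : P → ℝ) (π : Equiv.Perm (ι × κ × P)),
      (∀ s, 0 < w s) ∧ ∑ s, w s = 1 ∧
      (∀ ω, p (π ω).1 * q (π ω).2.1 * w (π ω).2.2 = p ω.1 * q ω.2.1 * w ω.2.2) ∧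
      ∀ x y, ((n + 1 : ℝ) * T y x - 1) / (n + 2) * ((n : ℝ) / (n + 1)) ^ Fintype.card (ι ⊕ κ) ≤
        ∑ i : κ × P, if (π (x, i)).2.1 = y then q i.1 * w i.2 else 0 := by
  set g : ι ⊕ κ → ℝ := Sum.elim p q with hgdef
  have hg : ∀ z, 0 < g z := by rintro (x | y); exacts [hp x, hq y]
  have hg1 : ∀ z, g z ≤ 1 := by
    rintro (x | y)
    · rw [← hpsum]
      exact Finset.single_le_sum (fun z _ => (hp z).le) (Finset.mem_univ x)
    · rw [← hqsum]
      exact Finset.single_le_sum (fun z _ => (hq z).le) (Finset.mem_univ y)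
  set N := n + 1 with hN
  obtain ⟨π, hπ, hcard⟩ := exists_perm_transitionNumber hg hpsum hqsum h0 h1
    (fun y => congrFun hT y) N
  have hne : Nonempty (BathState g N) :=
    ⟨⟨⟨fun _ => 0, by simp [hN]⟩, ⟨0, Nat.ceil_pos.2 (div_pos (by positivity)
      (levelWeight_pos hg _))⟩⟩⟩
  set Z := ∑ s : BathState g N, levelWeight g s.1.1 with hZ
  have hZ0 : 0 < Z := Finset.sum_pos (fun s _ => levelWeight_pos hg _) Finset.univ_nonempty
  have hw : ∀ ω : ι × κ × BathState g N, p ω.1 * q ω.2.1 * (levelWeight g ω.2.2.1.1 / Z) =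
      levelWeight g (jointLabel ω) / Z := by
    intro ω
    rw [levelWeight_jointLabel]
    change _ = _ * p ω.1 * q ω.2.1 / Z
    ring
  refine ⟨BathState g N, inferInstance, hne, fun s => levelWeight g s.1.1 / Z, π,
    fun s => div_pos (levelWeight_pos hg _) hZ0, ?_, fun ω => ?_, fun x y => ?_⟩
  · rw [← Finset.sum_div, div_self hZ0.ne']
  · rw [hw, hw, hπ]
  · set S := ∑ i : κ × BathState g N,
      if (π (x, i)).2.1 = y then q i.1 * (levelWeight g i.2.1.1 / Z) else 0 with hS
    have hS0 : 0 ≤ S := Finset.sum_nonneg fun i _ => by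
      split_ifs
      · exact mul_nonneg (hq _).le (div_nonneg (levelWeight_pos hg _).le hZ0.le)
      · exact le_rfl
    have hpS : p x * S = ∑ ω : ι × κ × BathState g N with ω.1 = x ∧ (π ω).2.1 = y,
        levelWeight g (jointLabel ω) / Z := by
      rw [Finset.sum_filter, Fintype.sum_prod_type, Finset.sum_eq_single x]
      · rw [hS, Finset.mul_sum]
        refine Finset.sum_congr rfl fun i _ => ?_
        rw [← hw]
        by_cases hi : (π (x, i)).2.1 = y
        · simp [hi, mul_assoc]
        · simp [hi]
      · intro z _ hz
        exact Finset.sum_eq_zero fun i _ => if_neg fun h => hz h.1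
      · simp
    have hlow : ((n : ℝ) ^ Fintype.card (ι ⊕ κ)) * (p x * ((n + 1) * T y x - 1)) / Z ≤
        p x * S := by
      rw [hpS]
      calc ((n : ℝ) ^ Fintype.card (ι ⊕ κ)) * (p x * ((n + 1) * T y x - 1)) / Z
          = ∑ _k ∈ interiorLabels ι κ N, p x * ((n + 1) * T y x - 1) / Z := by
            rw [Finset.sum_const, interiorLabels, Fintype.card_piFinset, Finset.prod_const,
              Finset.card_univ, Nat.card_Ico,
              nsmul_eq_mul, hN, Nat.add_sub_cancel]
            push_cast
            ring
        _ ≤ ∑ k ∈ interiorLabels ι κ N, transitionNumber g T N k y x * levelWeight g k / Z := by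
            refine Finset.sum_le_sum fun k hk => div_le_div_of_nonneg_right ?_ hZ0.le
            have := le_transitionNumber_mul hg hg1 T hk x y
            rw [hN] at this
            push_cast at this
            exact this
        _ ≤ ∑ k ∈ interiorLabels ι κ N, ∑ ω : ι × κ × BathState g N with
              (ω.1 = x ∧ (π ω).2.1 = y) ∧ jointLabel ω = k, levelWeight g (jointLabel ω) / Z := by
            refine Finset.sum_le_sum fun k _ => ?_
            rw [Finset.sum_congr rfl fun ω hω => by rw [(Finset.mem_filter.1 hω).2.2],
              Finset.sum_const, nsmul_eq_mul, mul_div_assoc]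
            refine mul_le_mul_of_nonneg_right ?_ (div_nonneg (levelWeight_pos hg _).le hZ0.le)
            have h2 := hcard k x y
            rw [Fintype.card_subtype] at h2
            simp only [and_comm (b := jointLabel _ = k)]
            exact_mod_cast h2
        _ ≤ _ := by
            simp only [← Finset.filter_filter]
            exact Finset.sum_fiberwise_le_sum_of_sum_fiber_nonneg fun k _ =>
              Finset.sum_nonneg fun ω _ => div_nonneg (levelWeight_pos hg _).le hZ0.le
    have hlow' : ((n : ℝ) ^ Fintype.card (ι ⊕ κ)) * ((n + 1) * T y x - 1) / Z ≤ S := by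
      refine le_of_mul_le_mul_left ?_ (hp x)
      calc _ = _ := by ring
        _ ≤ _ := hlow
    rcases le_total ((n + 1 : ℝ) * T y x - 1) 0 with hneg | hnonneg
    · refine le_trans ?_ hS0
      exact mul_nonpos_of_nonpos_of_nonneg
        (div_nonpos_of_nonpos_of_nonneg hneg (by positivity)) (by positivity)
    · refine le_trans ?_ hlow'
      have hZle : Z ≤ (n + 1 : ℝ) ^ Fintype.card (ι ⊕ κ) * (n + 2) := by
        have := sum_levelWeight_le hg hg1 N
        rw [hN] at this
        push_cast at this
        rw [add_assoc (n : ℝ) 1 1, one_add_one_eq_two] at this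
        exact this
      calc _ = (n : ℝ) ^ Fintype.card (ι ⊕ κ) * ((n + 1) * T y x - 1) /
            ((n + 1 : ℝ) ^ Fintype.card (ι ⊕ κ) * (n + 2)) := by
            rw [div_pow, div_mul_div_comm, mul_comm (n + 2 : ℝ), mul_comm ((n : ℝ) ^ _)]
        _ ≤ _ := div_le_div_of_nonneg_left (by positivity) hZ0 hZle

end Transitions

/-! ### Approximation of stochastic matrices -/

section Approximation

/-- Stochastic matrices that are asymptotically bounded below by a stochastic matrix converge
to it. -/
lemma tendsto_of_stochastic_of_le {ι κ : Type*} [Fintype κ] {T : Matrix κ ι ℝ}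
    (h1 : ∀ x, ∑ y, T y x = 1) {Ts Ls : ℕ → Matrix κ ι ℝ} (hTs : ∀ n x, ∑ y, Ts n y x = 1)
    (hle : ∀ n y x, Ls n y x ≤ Ts n y x) (hLs : ∀ y x, Tendsto (fun n => Ls n y x) atTop (𝓝 (T y x)))
    (y : κ) (x : ι) : Tendsto (fun n => Ts n y x) atTop (𝓝 (T y x)) := by
  classical
  have hup : ∀ n, Ts n y x ≤ 1 - ∑ z ∈ Finset.univ.erase y, Ls n z x := by
    intro n
    rw [le_sub_iff_add_le, ← hTs n x, ← Finset.add_sum_erase _ _ (Finset.mem_univ y)]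
    gcongr with z
    exact hle n z x
  have hlim : Tendsto (fun n => 1 - ∑ z ∈ Finset.univ.erase y, Ls n z x) atTop (𝓝 (T y x)) := by
    have h2 : T y x = 1 - ∑ z ∈ Finset.univ.erase y, T z x := by
      rw [eq_sub_iff_add_eq, Finset.add_sum_erase _ (fun z => T z x) (Finset.mem_univ y), h1]
    rw [h2]
    exact tendsto_const_nhds.sub (tendsto_finsetSum _ fun z _ => hLs z x)
  exact tendsto_of_tendsto_of_tendsto_of_le_of_le (hLs y x) hlim (fun n => hle n y x) hup

lemma tendsto_transition_bound (t : ℝ) (D : ℕ) :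
    Tendsto (fun n : ℕ => ((n + 1 : ℝ) * t - 1) / (n + 2) * ((n : ℝ) / (n + 1)) ^ D) atTop
      (𝓝 t) := by
  have h1 : Tendsto (fun n : ℕ => (n : ℝ) / (n + 1)) atTop (𝓝 1) := tendsto_natCast_div_add_atTop 1
  have h2 : Tendsto (fun n : ℕ => (n : ℝ) / (n + 2)) atTop (𝓝 1) := tendsto_natCast_div_add_atTop 2
  have h3 : Tendsto (fun n : ℕ => (1 : ℝ) / (n + 2)) atTop (𝓝 0) :=
    tendsto_const_nhds.div_atTop (tendsto_natCast_atTop_atTop.atTop_add tendsto_const_nhds)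
  have h4 := ((h2.mul_const t).add (h3.mul_const (t - 1))).mul (h1.pow D)
  simp only [one_mul, zero_mul, add_zero, one_pow, mul_one] at h4
  refine h4.congr fun n => ?_
  congr 1
  ring

variable {ι κ : Type*} [Fintype ι] [DecidableEq ι] [Fintype κ] [DecidableEq κ]
  {A : PhysSystem ι} {B : PhysSystem κ} (a : EnergyBasis A) (b : EnergyBasis B)

lemma continuous_classicalMap (X : Matrix ι ι ℂ) :
    Continuous fun t : Matrix κ ι ℂ => classicalMap a b t X := by
  simp only [classicalMap_apply, EnergyBasis.lift_apply]
  fun_prop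

lemma sum_prod_mul_eq_one {α δ : Type*} [Fintype α] [Fintype δ] {f : α → ℝ} {w : δ → ℝ}
    (hf : ∑ i, f i = 1) (hw : ∑ s, w s = 1) : ∑ i : α × δ, f i.1 * w i.2 = 1 := by
  rw [Fintype.sum_prod_type]
  simp only [← Finset.mul_sum, hw, mul_one, hf]

/-- Every Gibbs preserving stochastic matrix is approximated by thermal operations. The
decoherence that these entail is automatic by relative non-degeneracy. -/
lemma classicalMap_mem_CTO [Nonempty ι] [Nonempty κ] {β : ℝ} (hβ : β ≠ 0)
    (hab : RelativelyNondegenerate a b) {T : Matrix κ ι ℝ} (h0 : ∀ y x, 0 ≤ T y x)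
    (h1 : ∀ x, ∑ y, T y x = 1) (hT : T *ᵥ a.gibbsWeight β = b.gibbsWeight β) :
    classicalMap a b (T.map Complex.ofReal) ∈ CTO β A B := by
  refine ⟨classicalMap_mem_CPTP a b h0 h1, ?_⟩
  have hE : ∀ n : ℕ, ∃ E ∈ TO β A B, ∃ T' : Matrix κ ι ℝ,
      E = classicalMap a b (T'.map Complex.ofReal) ∧ (∀ x, ∑ y, T' y x = 1) ∧
      ∀ y x, ((n + 1 : ℝ) * T y x - 1) / (n + 2) * ((n : ℝ) / (n + 1)) ^ Fintype.card (ι ⊕ κ) ≤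
        T' y x := by
    intro n
    obtain ⟨P, _, _, w, π, hw, hwsum, hπ, hbound⟩ := exists_bath_perm (a.gibbsWeight_pos β)
      (b.gibbsWeight_pos β) (a.sum_gibbsWeight β) (b.sum_gibbsWeight β) h0 h1 hT n
    -- The incoming bath is `B` joined with `P` and the outgoing bath is `A` joined with `P`.
    let π' : ι × (κ × P) ≃ κ × (ι × P) := π.trans
      ⟨fun i => (i.2.1, i.1, i.2.2), fun i => (i.2.1, i.1, i.2.2), fun _ => rfl, fun _ => rfl⟩
    obtain ⟨E, hE, hcoeff⟩ := exists_TO_of_equiv a b hβ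
      (g := fun i : κ × P => b.gibbsWeight β i.1 * w i.2)
      (g' := fun i : ι × P => a.gibbsWeight β i.1 * w i.2)
      (fun i => mul_pos (b.gibbsWeight_pos β _) (hw _))
      (fun i => mul_pos (a.gibbsWeight_pos β _) (hw _))
      (sum_prod_mul_eq_one (b.sum_gibbsWeight β) hwsum)
      (sum_prod_mul_eq_one (a.sum_gibbsWeight β) hwsum) π' (fun i => by
        have h2 := hπ i
        change b.gibbsWeight β (π i).2.1 * (a.gibbsWeight β (π i).1 * w (π i).2.2) = _
        linear_combination h2)
    refine ⟨E, hE, Matrix.of fun y x => ∑ i : κ × P,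
      if (π (x, i)).2.1 = y then b.gibbsWeight β i.1 * w i.2 else 0, ?_, fun x => ?_,
      fun y x => hbound x y⟩
    · conv_lhs => rw [eq_classicalMap a b (energyCoeff_eq_zero_of_TO a b hβ hab hE)]
      congr 1
      ext y x
      exact hcoeff x y
    · simp only [Matrix.of_apply]
      rw [Finset.sum_comm]
      simp only [Finset.sum_ite_eq, Finset.mem_univ, if_true]
      exact sum_prod_mul_eq_one (b.sum_gibbsWeight β) hwsum
  choose Es hEs Ts hEq hsum hle using hE
  refine ⟨Es, hEs, fun X => ?_⟩
  have hlim : Tendsto (fun n => (Ts n).map Complex.ofReal) atTop (𝓝 (T.map Complex.ofReal)) := by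
    refine tendsto_pi_nhds.2 fun y => tendsto_pi_nhds.2 fun x => ?_
    exact (Complex.continuous_ofReal.tendsto _).comp (tendsto_of_stochastic_of_le h1 hsum
      (Ls := fun n => Matrix.of fun y x => ((n + 1 : ℝ) * T y x - 1) / (n + 2) *
        ((n : ℝ) / (n + 1)) ^ Fintype.card (ι ⊕ κ))
      hle (fun y x => tendsto_transition_bound _ _) y x)
  simp only [hEq]
  exact ((continuous_classicalMap a b X).tendsto _).comp hlim

lemma IsDensity.nonempty {ρ : Matrix ι ι ℂ} (hρ : IsDensity ρ) : Nonempty ι := by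
  by_contra h
  rw [not_nonempty_iff] at h
  have := hρ.2
  simp [Matrix.trace] at this

/-- The diagonal of the output of a classical processing. -/
lemma diagVec_classicalMap {T : Matrix κ ι ℝ} {M : Matrix ι ι ℂ} (hM : M.IsHermitian) :
    b.diagVec (classicalMap a b (T.map Complex.ofReal) M) = T *ᵥ a.diagVec M := by
  ext y
  have h : ((T.map Complex.ofReal) *ᵥ fun x => a.rep M x x) y = ((T *ᵥ a.diagVec M) y : ℝ) := by
    simp [Matrix.mulVec, dotProduct, a.rep_apply_self_eq_diagVec hM]
  rw [EnergyBasis.diagVec, classicalMap_apply, b.rep_lift, diagonal_apply_eq, h, Complex.ofReal_re]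

end Approximation

end Athermality

open Athermality
theorem mainTheorem8 {ι κ : Type*} [Fintype ι] [DecidableEq ι] [Fintype κ] [DecidableEq κ]
    (β : ℝ) (hβ : 0 < β)
    (A : PhysSystem ι) (B : PhysSystem κ) (a : EnergyBasis A) (b : EnergyBasis B)
    (hAB : RelativelyNondegenerate a b)
    (F : Set (Matrix ι ι ℂ →ₗ[ℂ] Matrix κ κ ℂ)) (hF : F = CTO β A B ∨ F = GPC β A B)
    (ρ : Matrix ι ι ℂ) (hρ : IsDensity ρ) (σ : Matrix κ κ ℂ) (hσ : IsDensity σ) :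
    Converts F ρ σ ↔
      (b.rep σ).IsDiag ∧
        RelMajorizes (a.diagVec ρ) (a.diagVec (gibbs β A))
          (b.diagVec σ) (b.diagVec (gibbs β B)) := by
  have := hρ.nonempty
  have := hσ.nonempty
  constructor
  · rintro ⟨E, hE, rfl⟩
    have h : E ∈ CPTP ι κ ∧ E (gibbs β A) = gibbs β B ∧
        ∀ x x' y y', ¬ (x = x' ∧ y = y') → energyCoeff a b E x x' y y' = 0 := by
      rcases hF with rfl | rfl
      · exact ⟨hE.1, map_gibbs_of_CTO hE, energyCoeff_eq_zero_of_CTO a b hβ.ne' hAB hE⟩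
      · exact ⟨hE.1.1, hE.1.2, energyCoeff_eq_zero_of_COV a b hAB hE.2⟩
    obtain ⟨hCPTP, hgibbs, hcoeff⟩ := h
    obtain ⟨T, h0, h1, rfl⟩ := exists_stochastic_of_energyCoeff a b hCPTP hcoeff
    refine ⟨?_, T, h0, h1, diagVec_classicalMap a b hρ.1.isHermitian, ?_⟩
    · rw [classicalMap_apply, b.rep_lift]
      exact Matrix.isDiag_diagonal _
    · rw [← hgibbs]
      exact diagVec_classicalMap a b (gibbs_isHermitian a β)
  · rintro ⟨hdiag, T, h0, h1, hr, hg⟩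
    refine ⟨classicalMap a b (T.map Complex.ofReal), ?_, classicalMap_eq_of_diagVec a b
      hρ.1.isHermitian hσ.1.isHermitian hdiag hr⟩
    rcases hF with rfl | rfl
    · rw [a.diagVec_gibbs, b.diagVec_gibbs] at hg
      exact classicalMap_mem_CTO a b hβ.ne' hAB h0 h1 hg.symm
    · have hCPTP := classicalMap_mem_CPTP a b h0 h1
      refine ⟨⟨hCPTP, classicalMap_eq_of_diagVec a b (gibbs_isHermitian a β)
        (gibbs_isHermitian b β) ?_ hg⟩, classicalMap_mem_COV a b hCPTP⟩
      rw [b.rep_gibbs]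
      exact Matrix.isDiag_diagonal _
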